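/- Let $\nu\in(0,1)$ and $c_\nu=\nu^2-\tfrac14$. All functions are real-valued. Let $A_\nu$ be the unbounded operator on $L^2(-1,1)$ given by $A_\nu f=-\partial_{xx}f+\frac{c_\nu}{x^2}f$, where $\partial_{xx}$ is the distributional derivative on $(-1,0)\cup(0,1)$, with domain $D(A_\nu)$ consisting of all $f=f_r+f_s\in L^2(-1,1)$ such that $f_r\in H^2(-1,1)$, $f_r(0)=f_r'(0)=0$, and, for some real constants $c_1^\pm,c_2^\pm$, $$f_s(x)=c_1^-|x|^{\nu+\frac12}+c_2^-|x|^{-\nu+\frac12}\ \text{ on }(-1,0),\qquad f_s(x)=c_1^+|x|^{\nu+\frac12}+c_2^+|x|^{-\nu+\frac12}\ \text{ on }(0,1),$$ with $f(-1)=f(1)=0$, $c_1^-+c_2^-+c_1^++c_2^+=0$ and $(\nu+\tfrac12)c_1^-+(-\nu+\tfrac12)c_2^-=(\nu+\tfrac12)c_1^++(-\nu+\tfrac12)c_2^+$. For $x>0$ let $J_{\pm\nu}(x)=\sum_{k\ge0}\frac{(-1)^k}{k!\,\Gamma(k\pm\nu+1)}\left(\frac x2\right)^{2k\pm\nu}$.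 Let $E>0$. Then $E$ is an eigenvalue of $A_\nu$ if and only if $$(+)\quad J_\nu(\sqrt E)\Big(\tfrac{\sqrt E}{2}\Big)^{-2\nu}\frac{\Gamma(\nu+1)}{\Gamma(1-\nu)}=J_{-\nu}(\sqrt E)\qquad\text{or}\qquad(-)\quad J_\nu(\sqrt E)\Big(\tfrac{\sqrt E}{2}\Big)^{-2\nu}\frac{\Gamma(\nu+1)}{\Gamma(1-\nu)}\,\frac{1-2\nu}{1+2\nu}=J_{-\nu}(\sqrt E).$$ If $E$ is an eigenvalue, then $J_\nu(\sqrt E)\neq0$. Moreover, with $R=\frac{\Gamma(\nu+1)}{\Gamma(1-\nu)}\big(\frac{\sqrt E}{2}\big)^{-2\nu}$: - if $(+)$ holds, the eigenspace $\{f\in D(A_\nu): A_\nu f=Ef\}$ is one-dimensional and is spanned by the function equal to $-R\sqrt{-x}\,J_\nu(-\sqrt E x)+\sqrt{-x}\,J_{-\nu}(-\sqrt E x)$ on $(-1,0)$ and to $-R\sqrt{x}\,J_\nu(\sqrt E x)+\sqrt{x}\,J_{-\nu}(\sqrt E x)$ on $(0,1)$; - if $(-)$ holds, the eigenspace is one-dimensional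 and is spanned by the function equal to $\frac{1-2\nu}{1+2\nu}R\sqrt{-x}\,J_\nu(-\sqrt E x)-\sqrt{-x}\,J_{-\nu}(-\sqrt E x)$ on $(-1,0)$ and to $-\frac{1-2\nu}{1+2\nu}R\sqrt{x}\,J_\nu(\sqrt E x)+\sqrt{x}\,J_{-\nu}(\sqrt E x)$ on $(0,1)$. -/

import Mathlib

open MeasureTheory Set Filter Topology
open scoped ContDiff

noncomputable section

namespace InvSq

/-- Lebesgue measure on `(-1, 1)`. -/
abbrev vol : Measure ℝ := volume.restrict (Ioo (-1 : ℝ) 1)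

/-- The real Hilbert space `L²(-1, 1)`. -/
abbrev L2 : Type := Lp ℝ 2 vol

/-- `φ ∈ C_c^∞(U)`. -/
def IsTest (U : Set ℝ) (φ : ℝ → ℝ) : Prop :=
  ContDiff ℝ ∞ φ ∧ HasCompactSupport φ ∧ tsupport φ ⊆ U

/-- `(-1, 0) ∪ (0, 1)`. -/
def punctured : Set ℝ := Ioo (-1) 0 ∪ Ioo 0 1

/-- `g` is the weak derivative of `f` on `(-1, 1)`. -/
def HasWeakDeriv (f g : L2) : Prop :=
  ∀ φ : ℝ → ℝ, IsTest (Ioo (-1) 1) φ → ∫ x, f x * deriv φ x ∂vol = -∫ x, g x * φ x ∂vol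

/-- The class `f` has a representative which is continuous (from within `[-1, 1]`) at the point
`x`, with the value `a` there. For `x ∈ [-1, 1]` there is at most one such `a`; if `f` has a
continuous representative on `[-1, 1]`, then `a` is its value at `x`. -/
def HasValueAt (f : L2) (x a : ℝ) : Prop :=
  ∃ u : ℝ → ℝ, f =ᵐ[vol] u ∧ ContinuousWithinAt u (Icc (-1) 1) x ∧ u x = a

/-- The function equal to `c₁⁻ |x|^(ν+1/2) + c₂⁻ |x|^(-ν+1/2)` on the left of `0`, and to
`c₁⁺ |x|^(ν+1/2) + c₂⁺ |x|^(-ν+1/2)` on the right. -/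
def singularFun (ν c₁m c₂m c₁p c₂p : ℝ) (x : ℝ) : ℝ :=
  if x < 0 then c₁m * |x| ^ (ν + 1 / 2) + c₂m * |x| ^ (-ν + 1 / 2)
  else c₁p * |x| ^ (ν + 1 / 2) + c₂p * |x| ^ (-ν + 1 / 2)

/-- `(-∂ₓₓ + c_ν / x²) f = g` in the sense of distributions on `(-1, 0) ∪ (0, 1)`, where
`c_ν = ν² - 1/4`. -/
def SolvesWeakly (ν : ℝ) (f g : L2) : Prop :=
  ∀ φ : ℝ → ℝ, IsTest punctured φ →
    ∫ x, f x * (-deriv (deriv φ) x + (ν ^ 2 - 1 / 4) / x ^ 2 * φ x) ∂vol = ∫ x, g x * φ x ∂vol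

/-! ### Linearity of these notions -/

theorem IsTest.mono {U V : Set ℝ} (hUV : U ⊆ V) {φ : ℝ → ℝ} (h : IsTest U φ) : IsTest V φ :=
  ⟨h.1, h.2.1, h.2.2.trans hUV⟩

theorem isTest_deriv {U : Set ℝ} {φ : ℝ → ℝ} (h : IsTest U φ) : IsTest U (deriv φ) :=
  ⟨(contDiff_infty_iff_deriv.1 h.1).2, h.2.1.deriv, (tsupport_deriv_subset).trans h.2.2⟩

theorem integrable_mul (f : L2) {k : ℝ → ℝ} (hk : Continuous k) (hc : HasCompactSupport k) :
    Integrable (fun x => f x * k x) vol := by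
  obtain ⟨C, hC⟩ := hc.exists_bound_of_continuous hk
  exact ((Lp.memLp f).integrable (by norm_num)).mul_bdd (c := C) hk.aestronglyMeasurable
    (Eventually.of_forall hC)

theorem continuous_potential_mul (c : ℝ) {φ : ℝ → ℝ} (h : IsTest punctured φ) :
    Continuous (fun x => c / x ^ 2 * φ x) := by
  rw [continuous_iff_continuousAt]
  intro x
  by_cases hx : x = 0
  · have h0 : x ∉ tsupport φ := by
      intro hm
      rcases h.2.2 hm with hm | hm
      · exact absurd hm.2 (by simp [hx])
      · exact absurd hm.1 (by simp [hx])
    have : (fun y => c / y ^ 2 * φ y) =ᶠ[𝓝 x] fun _ => 0 := by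
      filter_upwards [notMem_tsupport_iff_eventuallyEq.1 h0] with y hy
      simp [hy]
    exact (continuousAt_const (y := (0 : ℝ))).congr this.symm
  · have := h.1.continuous.continuousAt (x := x)
    fun_prop (disch := exact pow_ne_zero 2 hx)

theorem integrable_solves (ν : ℝ) (f : L2) {φ : ℝ → ℝ} (h : IsTest punctured φ) :
    Integrable
      (fun x => f x * (-deriv (deriv φ) x + (ν ^ 2 - 1 / 4) / x ^ 2 * φ x)) vol := by
  have h2 := isTest_deriv (isTest_deriv h)
  exact integrable_mul f (h2.1.continuous.neg.add (continuous_potential_mul _ h))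
    (h2.2.1.neg.add (h.2.1.mul_left))

theorem integral_add_mul (f g : L2) {k : ℝ → ℝ} (hf : Integrable (fun x => f x * k x) vol)
    (hg : Integrable (fun x => g x * k x) vol) :
    ∫ x, (f + g) x * k x ∂vol = ∫ x, f x * k x ∂vol + ∫ x, g x * k x ∂vol := by
  rw [← integral_add hf hg]
  refine integral_congr_ae ?_
  filter_upwards [Lp.coeFn_add f g] with x hx
  simp only [hx, Pi.add_apply]
  ring

theorem integral_smul_mul (r : ℝ) (f : L2) (k : ℝ → ℝ) :
    ∫ x, (r • f) x * k x ∂vol = r * ∫ x, f x * k x ∂vol := by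
  rw [← integral_const_mul]
  refine integral_congr_ae ?_
  filter_upwards [Lp.coeFn_smul r f] with x hx
  simp only [hx, Pi.smul_apply, smul_eq_mul]
  ring

theorem HasWeakDeriv.add {f g f' g' : L2} (h : HasWeakDeriv f f') (h' : HasWeakDeriv g g') :
    HasWeakDeriv (f + g) (f' + g') := by
  intro φ hφ
  have hd := isTest_deriv hφ
  have e₁ := integrable_mul f hd.1.continuous hd.2.1
  have e₂ := integrable_mul g hd.1.continuous hd.2.1
  have e₃ := integrable_mul f' hφ.1.continuous hφ.2.1
  have e₄ := integrable_mul g' hφ.1.continuous hφ.2.1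
  rw [integral_add_mul f g e₁ e₂, integral_add_mul f' g' e₃ e₄, h φ hφ, h' φ hφ]
  ring

theorem HasWeakDeriv.smul (r : ℝ) {f f' : L2} (h : HasWeakDeriv f f') :
    HasWeakDeriv (r • f) (r • f') := by
  intro φ hφ
  rw [integral_smul_mul, integral_smul_mul, h φ hφ]
  ring

theorem hasWeakDeriv_zero : HasWeakDeriv 0 0 := by
  intro φ _
  have h := fun k => integral_smul_mul 0 (0 : L2) k
  simp only [zero_smul, zero_mul] at h
  rw [h, h, neg_zero]

theorem HasValueAt.add {f g : L2} {x a b : ℝ} (hf : HasValueAt f x a) (hg : HasValueAt g x b) :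
    HasValueAt (f + g) x (a + b) := by
  obtain ⟨u, hu, hu', rfl⟩ := hf
  obtain ⟨v, hv, hv', rfl⟩ := hg
  exact ⟨u + v, (Lp.coeFn_add f g).trans (hu.add hv), hu'.add hv', rfl⟩

theorem HasValueAt.smul (r : ℝ) {f : L2} {x a : ℝ} (hf : HasValueAt f x a) :
    HasValueAt (r • f) x (r * a) := by
  obtain ⟨u, hu, hu', rfl⟩ := hf
  exact ⟨r • u, (Lp.coeFn_smul r f).trans (hu.const_smul r), hu'.const_smul r, rfl⟩

theorem hasValueAt_zero (x : ℝ) : HasValueAt 0 x 0 :=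
  ⟨0, Lp.coeFn_zero ℝ 2 vol, continuousWithinAt_const, rfl⟩

theorem singularFun_add (ν a b c d a' b' c' d' : ℝ) :
    singularFun ν a b c d + singularFun ν a' b' c' d'
      = singularFun ν (a + a') (b + b') (c + c') (d + d') := by
  funext x
  simp only [singularFun, Pi.add_apply]
  split_ifs <;> ring

theorem singularFun_smul (r ν a b c d : ℝ) :
    r • singularFun ν a b c d = singularFun ν (r * a) (r * b) (r * c) (r * d) := by
  funext x
  simp only [singularFun, Pi.smul_apply, smul_eq_mul]
  split_ifs <;> ring

/-- `{f ∈ H²(-1, 1) : f(0) = f'(0) = 0}`. -/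
def H20 : Submodule ℝ L2 where
  carrier := {f | ∃ f' f'' : L2, HasWeakDeriv f f' ∧ HasWeakDeriv f' f'' ∧
    HasValueAt f 0 0 ∧ HasValueAt f' 0 0}
  zero_mem' := ⟨0, 0, hasWeakDeriv_zero, hasWeakDeriv_zero, hasValueAt_zero 0, hasValueAt_zero 0⟩
  add_mem' := by
    rintro f g ⟨f', f'', h₁, h₂, h₃, h₄⟩ ⟨g', g'', k₁, k₂, k₃, k₄⟩
    exact ⟨f' + g', f'' + g'', h₁.add k₁, h₂.add k₂, by simpa using h₃.add k₃,
      by simpa using h₄.add k₄⟩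
  smul_mem' := by
    rintro r f ⟨f', f'', h₁, h₂, h₃, h₄⟩
    exact ⟨r • f', r • f'', h₁.smul r, h₂.smul r, by simpa using h₃.smul r,
      by simpa using h₄.smul r⟩

/-- The domain `D(A_ν)`: all `f = f_r + f_s` with `f_r ∈ H20` and `f_s ∈ L²(-1, 1)` a function of
the form `singularFun`, such that `f(-1) = f(1) = 0` and the coefficients of `f_s` satisfy the two
transmission conditions. -/
def domain (ν : ℝ) : Submodule ℝ L2 where
  carrier := {f | HasValueAt f (-1) 0 ∧ HasValueAt f 1 0 ∧
    ∃ fr ∈ H20, ∃ fs : L2, ∃ c₁m c₂m c₁p c₂p : ℝ,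
      f = fr + fs ∧ fs =ᵐ[vol] singularFun ν c₁m c₂m c₁p c₂p ∧
      c₁m + c₂m + c₁p + c₂p = 0 ∧
      (ν + 1 / 2) * c₁m + (-ν + 1 / 2) * c₂m = (ν + 1 / 2) * c₁p + (-ν + 1 / 2) * c₂p}
  zero_mem' := by
    refine ⟨hasValueAt_zero _, hasValueAt_zero _, 0, H20.zero_mem, 0, 0, 0, 0, 0, by simp, ?_,
      by simp, by simp⟩
    filter_upwards [Lp.coeFn_zero ℝ 2 vol] with x hx
    rw [hx]
    simp [singularFun]
  add_mem' := by
    rintro f g ⟨h₁, h₂, fr, hfr, fs, a, b, c, d, rfl, hs, t₁, t₂⟩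
      ⟨k₁, k₂, gr, hgr, gs, a', b', c', d', rfl, ks, u₁, u₂⟩
    refine ⟨by simpa using h₁.add k₁, by simpa using h₂.add k₂, fr + gr, H20.add_mem hfr hgr,
      fs + gs, a + a', b + b', c + c', d + d', by abel, ?_, by linarith, by linarith⟩
    rw [← singularFun_add]
    exact (Lp.coeFn_add fs gs).trans (hs.add ks)
  smul_mem' := by
    rintro r f ⟨h₁, h₂, fr, hfr, fs, a, b, c, d, rfl, hs, t₁, t₂⟩
    refine ⟨by simpa using h₁.smul r, by simpa using h₂.smul r, r • fr, H20.smul_mem r hfr,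
      r • fs, r * a, r * b, r * c, r * d, by simp, ?_, by linear_combination r * t₁,
      by linear_combination r * t₂⟩
    rw [← singularFun_smul]
    exact (Lp.coeFn_smul r fs).trans (hs.const_smul r)

/-- The graph of `A_ν`: pairs `(f, g)` with `f ∈ D(A_ν)` and `g = (-∂ₓₓ + c_ν / x²) f`. -/
def opGraph (ν : ℝ) : Submodule ℝ (L2 × L2) where
  carrier := {p | p.1 ∈ domain ν ∧ SolvesWeakly ν p.1 p.2}
  zero_mem' := by
    refine ⟨(domain ν).zero_mem, fun φ _ => ?_⟩
    have h := integral_smul_mul 0 (0 : L2)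
    simp only [zero_smul, zero_mul] at h
    rw [Prod.fst_zero, Prod.snd_zero, h, h φ]
  add_mem' := by
    rintro ⟨f, g⟩ ⟨f', g'⟩ ⟨h₁, h₂⟩ ⟨k₁, k₂⟩
    refine ⟨(domain ν).add_mem h₁ k₁, fun φ hφ => ?_⟩
    have e₁ := h₂ φ hφ
    have e₂ := k₂ φ hφ
    dsimp only [Prod.mk_add_mk] at e₁ e₂ ⊢
    rw [integral_add_mul f f' (integrable_solves ν f hφ) (integrable_solves ν f' hφ),
      integral_add_mul g g' (integrable_mul g hφ.1.continuous hφ.2.1)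
        (integrable_mul g' hφ.1.continuous hφ.2.1), e₁, e₂]
  smul_mem' := by
    rintro r ⟨f, g⟩ ⟨h₁, h₂⟩
    refine ⟨(domain ν).smul_mem r h₁, fun φ hφ => ?_⟩
    have e₁ := h₂ φ hφ
    dsimp only [Prod.smul_mk] at e₁ ⊢
    rw [integral_smul_mul, integral_smul_mul, e₁]

/-- The value `g` in a pair `(f, g)` of the graph is determined by `f`. -/
theorem opGraph_functional (ν : ℝ) :
    ∀ p ∈ opGraph ν, p.1 = 0 → p.2 = 0 := by
  rintro ⟨f, g⟩ ⟨-, h⟩ hf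
  dsimp only at hf h ⊢
  subst hf
  have hz := fun k => integral_smul_mul 0 (0 : L2) k
  simp only [zero_smul, zero_mul] at hz
  have hU : IsOpen punctured := isOpen_Ioo.union isOpen_Ioo
  have hsub : punctured ⊆ Ioo (-1 : ℝ) 1 := by
    rintro x (hx | hx)
    · exact ⟨hx.1, hx.2.trans one_pos⟩
    · exact ⟨by linarith [hx.1], hx.2⟩
  have hint : Integrable g vol := (Lp.memLp g).integrable (by norm_num)
  have key : ∀ᵐ x ∂vol, x ∈ punctured → g x = 0 := by
    refine hU.ae_eq_zero_of_integral_contDiff_smul_eq_zero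
      (hint.locallyIntegrable.locallyIntegrableOn _) fun φ h₁ h₂ h₃ => ?_
    have := h φ ⟨h₁, h₂, h₃⟩
    rw [hz] at this
    simpa [mul_comm] using this.symm
  have hne : ∀ᵐ x ∂vol, x ≠ 0 :=
    ae_restrict_of_ae (by simp [ae_iff])
  refine Lp.ext ?_
  filter_upwards [key, hne, Lp.coeFn_zero ℝ 2 vol,
    ae_restrict_mem (measurableSet_Ioo (a := (-1 : ℝ)) (b := 1))] with x hx h0 hzero hmem
  rw [hzero]
  refine hx ?_
  rcases lt_or_gt_of_ne h0 with h' | h'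
  · exact Or.inl ⟨hmem.1, h'⟩
  · exact Or.inr ⟨h', hmem.2⟩

/-- The unbounded operator `A_ν f = -∂ₓₓ f + (c_ν / x²) f` on `L²(-1, 1)`, with domain `D(A_ν)`,
given by its graph. (By Hardy's inequality, `-∂ₓₓ f + (c_ν / x²) f` is in `L²(-1, 1)` for all
`f ∈ D(A_ν)`, when `0 < ν < 1`.) -/
def op (ν : ℝ) : L2 →ₗ.[ℝ] L2 := (opGraph ν).toLinearPMap

/-- The space `{f ∈ D(A) : A f = E f}`. -/
def eigenspace (A : L2 →ₗ.[ℝ] L2) (E : ℝ) : Submodule ℝ L2 where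
  carrier := {f | ∃ hf : f ∈ A.domain, A ⟨f, hf⟩ = E • f}
  zero_mem' := ⟨A.domain.zero_mem, by rw [smul_zero]; exact A.map_zero⟩
  add_mem' := by
    rintro f g ⟨hf, h⟩ ⟨hg, k⟩
    refine ⟨A.domain.add_mem hf hg, ?_⟩
    rw [smul_add, ← h, ← k, ← A.map_add]
    rfl
  smul_mem' := by
    rintro r f ⟨hf, h⟩
    refine ⟨A.domain.smul_mem r hf, ?_⟩
    rw [smul_comm, ← h, ← A.map_smul]
    rfl

/-- `E` is an eigenvalue of `A`. -/
def IsEigenvalue (A : L2 →ₗ.[ℝ] L2) (E : ℝ) : Prop :=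
  ∃ f : A.domain, f ≠ 0 ∧ A f = E • (f : L2)

/-- The Bessel function of the first kind `J_ν(x)`, for `x > 0`. (`Real.Gamma` is `0` at the
non-positive integers, so that `1 / Γ` is `0` there.) -/
def besselJ (ν x : ℝ) : ℝ :=
  ∑' k : ℕ, (-1) ^ k / ((k.factorial : ℝ) * Real.Gamma (k + ν + 1)) *
    (x / 2) ^ (2 * (k : ℝ) + ν)

/-- The constant `Γ(ν+1) / Γ(1-ν) * (√E / 2)^(-2ν)`. -/
def ratio (ν E : ℝ) : ℝ :=
  Real.Gamma (ν + 1) / Real.Gamma (1 - ν) * (√E / 2) ^ (-2 * ν)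

/-- The generator of the eigenspace in the first (even) case. -/
def evenFun (ν E : ℝ) (x : ℝ) : ℝ :=
  if x < 0 then
    -(ratio ν E) * √(-x) * besselJ ν (-√E * x) + √(-x) * besselJ (-ν) (-√E * x)
  else
    -(ratio ν E) * √x * besselJ ν (√E * x) + √x * besselJ (-ν) (√E * x)

/-- The generator of the eigenspace in the second (odd) case. -/
def oddFun (ν E : ℝ) (x : ℝ) : ℝ :=
  if x < 0 then
    (1 - 2 * ν) / (1 + 2 * ν) * ratio ν E * √(-x) * besselJ ν (-√E * x)
      - √(-x) * besselJ (-ν) (-√E * x)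
  else
    -((1 - 2 * ν) / (1 + 2 * ν)) * ratio ν E * √x * besselJ ν (√E * x)
      + √x * besselJ (-ν) (√E * x)

end InvSq

end

open MeasureTheory Set Filter Topology
open scoped ContDiff

namespace InvSq

/-! On each half-interval, after reflecting the left one, an eigenfunction solves `-f'' + (c_ν / x²)
f = E f` in the weak sense. The classical solutions `√x J_{±ν}(√E x)` have a nonzero Wronskian. By
variation of constants, a test function orthogonal to both is the image of a test function under
`-∂ₓₓ + c_ν / x² - E`. A weak solution therefore vanishes, as a functional, on the common kernel of
these two solutions, so it is a combination of them (`exists_eq_besselSol_of_weak`).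

The domain conditions then become conditions on the four coefficients `am, bm, ap, bp`. A function
in `H20` is `O(x^{3/2})` at the origin, whereas the exponents `±ν + 1/2` are less than `3/2`. The
singular part must therefore consist of the leading terms of the two Bessel series
(`singular_coeff_eq`). Conversely, removing those terms raises the exponents by `2` and leaves a
function of `H20` (`mem_eigenspace_of_ae_eq_glue`).

The result is a homogeneous linear system with two Dirichlet and two transmission equations
(`mem_eigenspace_op_iff`), in which `ratio ν E` is the quotient of the leading coefficients of the
two solutions. Adding and subtracting the equations of the two halves decouples the system: the even
part has a nonzero solution exactly under `(+)`, the odd part exactly under `(-)`. The Wronskian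
rules out `J_ν` and `J_{-ν}` vanishing together at `√E`. The two conditions exclude each other
because `4 ν R ≠ 0`, so each eigenspace is a line. -/

/-! ### Everywhere convergent generalized power series. -/

/-- The power series with coefficients `a` converges absolutely everywhere. -/
def EntireCoeff (a : ℕ → ℝ) : Prop := ∀ r : ℝ, Summable fun k => a k * r ^ k

/-- The sum of the power series with coefficients `a`. -/
noncomputable def powerSum (a : ℕ → ℝ) (t : ℝ) : ℝ := ∑' k, a k * t ^ k

/-- The generalized power series `x ^ s * ∑ aₖ x ^ (2 k)`. -/
noncomputable def rpowSeries (s : ℝ) (a : ℕ → ℝ) (x : ℝ) : ℝ := x ^ s * powerSum a (x ^ 2)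

/-- The coefficients of the derivative of `rpowSeries s a`. -/
def rpowDerivCoeff (s : ℝ) (a : ℕ → ℝ) (k : ℕ) : ℝ := (s + 2 * k) * a k

namespace EntireCoeff

variable {a b : ℕ → ℝ}

theorem add (ha : EntireCoeff a) (hb : EntireCoeff b) : EntireCoeff (fun k => a k + b k) :=
  fun r => ((ha r).add (hb r)).congr fun k => by ring

theorem const_mul (c : ℝ) (ha : EntireCoeff a) : EntireCoeff (fun k => c * a k) :=
  fun r => ((ha r).mul_left c).congr fun k => by ring

/-- Since `k ≤ 2 ^ k`, the factor `k` is absorbed by doubling the argument. -/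
theorem natCast_mul (ha : EntireCoeff a) : EntireCoeff (fun k => k * a k) := by
  intro r
  refine Summable.of_norm_bounded (ha (2 * |r|)).norm fun k => ?_
  have h : (k : ℝ) ≤ 2 ^ k := by exact_mod_cast Nat.lt_two_pow_self.le
  simp only [norm_mul, norm_pow, Real.norm_eq_abs, Nat.abs_cast, abs_abs, Nat.abs_ofNat]
  rw [mul_pow]
  have : 0 ≤ |a k| * |r| ^ k := by positivity
  nlinarith

theorem tail (ha : EntireCoeff a) : EntireCoeff (fun k => a (k + 1)) := by
  intro r
  -- Comparing at `|r| + 1 ≥ 1` makes the extra power harmless and avoids dividing by `r`, which may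
  -- be `0`.
  refine Summable.of_norm_bounded ((summable_nat_add_iff 1).2 (ha (|r| + 1)).norm) fun k => ?_
  simp only [norm_mul, norm_pow, Real.norm_eq_abs]
  have h0 : 0 ≤ |r| := abs_nonneg r
  rw [abs_of_nonneg (by positivity : (0 : ℝ) ≤ |r| + 1), pow_succ]
  have h1 : |r| ^ k ≤ (|r| + 1) ^ k := by gcongr; linarith
  have h2 : (|r| + 1) ^ k ≤ (|r| + 1) ^ k * (|r| + 1) :=
    le_mul_of_one_le_right (by positivity) (by linarith)
  exact mul_le_mul_of_nonneg_left (h1.trans h2) (abs_nonneg _)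

theorem rpowDerivCoeff (s : ℝ) (ha : EntireCoeff a) : EntireCoeff (rpowDerivCoeff s a) := by
  intro r
  refine (((ha.const_mul s).add (ha.natCast_mul.const_mul 2)) r).congr fun k => ?_
  simp only [InvSq.rpowDerivCoeff]
  ring

/-- Termwise differentiation on the ball of radius `|t| + 1`, where the differentiated series is
dominated by its value at the radius. -/
theorem hasDerivAt (ha : EntireCoeff a) (t : ℝ) :
    HasDerivAt (powerSum a) (∑' k : ℕ, a k * (k * t ^ (k - 1))) t := by
  set R : ℝ := |t| + 1
  have hR : 0 < R := by positivity
  have hu : Summable fun k : ℕ => |a k| * (k * R ^ (k - 1)) := by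
    refine ((ha.natCast_mul R).norm.mul_left R⁻¹).congr fun k => ?_
    simp only [norm_mul, norm_pow, Real.norm_eq_abs, Nat.abs_cast, abs_of_pos hR]
    rcases k with _ | k
    · simp
    · simp only [Nat.add_sub_cancel, pow_succ]
      field_simp
  refine hasDerivAt_tsum_of_isPreconnected hu (Metric.isOpen_ball (α := ℝ) (x := 0) (ε := R))
    (convex_ball _ _).isPreconnected (fun k y _ => (hasDerivAt_pow k y).const_mul (a k))
    (fun k y hy => ?_) (Metric.mem_ball_self hR) (ha 0) (by simp [R])
  have hy' : |y| ≤ R := by simpa using (mem_ball_zero_iff.1 hy).le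
  simp only [norm_mul, norm_pow, Real.norm_eq_abs, Nat.abs_cast]
  gcongr

theorem mul_deriv_eq (t : ℝ) :
    t * ∑' k : ℕ, a k * (k * t ^ (k - 1)) = powerSum (fun k => k * a k) t := by
  rw [powerSum, ← tsum_mul_left]
  refine tsum_congr fun k => ?_
  rcases k with _ | k
  · simp
  · simp only [Nat.add_sub_cancel, pow_succ]
    ring

theorem continuous (ha : EntireCoeff a) : Continuous (powerSum a) :=
  continuous_iff_continuousAt.2 fun t => (ha.hasDerivAt t).continuousAt

end EntireCoeff

section

variable {a b : ℕ → ℝ}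

theorem powerSum_zero : powerSum a 0 = a 0 := by
  rw [powerSum, tsum_eq_single 0 fun k hk => by simp [hk]]
  simp

theorem powerSum_add (ha : EntireCoeff a) (hb : EntireCoeff b) (t : ℝ) :
    powerSum (fun k => a k + b k) t = powerSum a t + powerSum b t := by
  rw [powerSum, powerSum, powerSum, ← (ha t).tsum_add (hb t)]
  exact tsum_congr fun k => by ring

theorem powerSum_const_mul (c t : ℝ) : powerSum (fun k => c * a k) t = c * powerSum a t := by
  rw [powerSum, powerSum, ← tsum_mul_left]
  exact tsum_congr fun k => by ring

theorem powerSum_eq_add_tail (ha : EntireCoeff a) (t : ℝ) :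
    powerSum a t = a 0 + t * powerSum (fun k => a (k + 1)) t := by
  rw [powerSum, (ha t).tsum_eq_zero_add, powerSum, ← tsum_mul_left]
  simp only [pow_zero, mul_one, pow_succ]
  congr 1
  exact tsum_congr fun k => by ring

theorem powerSum_rpowDerivCoeff (s : ℝ) (ha : EntireCoeff a) (t : ℝ) :
    powerSum (rpowDerivCoeff s a) t
      = s * powerSum a t + 2 * (t * ∑' k : ℕ, a k * (k * t ^ (k - 1))) := by
  rw [EntireCoeff.mul_deriv_eq, ← powerSum_const_mul, ← powerSum_const_mul,
    ← powerSum_add (ha.const_mul s) (ha.natCast_mul.const_mul 2)]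
  congr 1
  funext k
  simp only [rpowDerivCoeff]
  ring

theorem hasDerivAt_rpowSeries (s : ℝ) (ha : EntireCoeff a) {x : ℝ} (hx : 0 < x) :
    HasDerivAt (rpowSeries s a) (rpowSeries (s - 1) (rpowDerivCoeff s a) x) x := by
  have h1 := Real.hasDerivAt_rpow_const (x := x) (p := s) (Or.inl hx.ne')
  have h2 := (ha.hasDerivAt (x ^ 2)).comp x (hasDerivAt_pow 2 x)
  refine (h1.mul h2).congr_deriv ?_
  rw [rpowSeries, powerSum_rpowDerivCoeff s ha]
  have : x ^ s = x ^ (s - 1) * x := by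
    rw [Real.rpow_sub_one hx.ne']
    field_simp
  rw [this]
  simp only [Function.comp_apply, Nat.cast_ofNat, Nat.add_one_sub_one, pow_one]
  ring

theorem rpowSeries_eq_add_tail (s : ℝ) (ha : EntireCoeff a) {x : ℝ} (hx : 0 < x) :
    rpowSeries s a x = a 0 * x ^ s + rpowSeries (s + 2) (fun k => a (k + 1)) x := by
  have : x ^ (s + 2) = x ^ s * x ^ 2 := by
    rw [Real.rpow_add hx, Real.rpow_ofNat]
  rw [rpowSeries, rpowSeries, powerSum_eq_add_tail ha, this]
  ring

/-- The derivative is again a generalized power series, with exponent `s - 1` and other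
coefficients; hence the induction has to vary both `s` and `a`. -/
theorem contDiffOn_rpowSeries (s : ℝ) (ha : EntireCoeff a) :
    ContDiffOn ℝ ∞ (rpowSeries s a) (Ioi 0) := by
  refine contDiffOn_infty.2 fun n => ?_
  induction n generalizing s a with
  | zero =>
    exact contDiffOn_zero.2 fun x hx =>
      (hasDerivAt_rpowSeries s ha hx).continuousAt.continuousWithinAt
  | succ n ih =>
    rw [Nat.cast_succ, contDiffOn_succ_iff_deriv_of_isOpen isOpen_Ioi]
    refine ⟨fun x hx => (hasDerivAt_rpowSeries s ha hx).differentiableAt.differentiableWithinAt,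
      by simp, (ih (s - 1) (ha.rpowDerivCoeff s)).congr fun x hx =>
        (hasDerivAt_rpowSeries s ha hx).deriv⟩

theorem exists_abs_rpowSeries_le (s : ℝ) (ha : EntireCoeff a) :
    ∃ C, 0 ≤ C ∧ ∀ x ∈ Ioc (0 : ℝ) 1, |rpowSeries s a x| ≤ C * x ^ s := by
  obtain ⟨C, hC⟩ := (isCompact_Icc (a := (0 : ℝ)) (b := 1)).exists_bound_of_continuousOn
    ha.continuous.continuousOn
  refine ⟨|C|, abs_nonneg C, fun x hx => ?_⟩
  have h := hC (x ^ 2) ⟨by positivity, pow_le_one₀ hx.1.le hx.2⟩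
  rw [rpowSeries, abs_mul, abs_of_nonneg (Real.rpow_nonneg hx.1.le s), mul_comm]
  exact mul_le_mul_of_nonneg_right (h.trans (le_abs_self C)) (Real.rpow_nonneg hx.1.le s)

theorem memLp_rpow {s : ℝ} (hs : -(1 / 2) < s) :
    MemLp (fun x : ℝ => x ^ s) 2 (volume.restrict (Ioo 0 1)) := by
  have hm : AEStronglyMeasurable (fun x : ℝ => x ^ s) (volume.restrict (Ioo 0 1)) :=
    ((measurable_id.pow_const s)).aestronglyMeasurable
  rw [memLp_two_iff_integrable_sq hm]
  have h := (intervalIntegral.intervalIntegrable_rpow' (a := 0) (b := 1)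
    (r := s * 2) (by linarith))
  rw [intervalIntegrable_iff_integrableOn_Ioo_of_le zero_le_one] at h
  refine h.congr_fun (fun x hx => ?_) measurableSet_Ioo
  simp only [Real.rpow_mul hx.1.le, Real.rpow_ofNat]

theorem memLp_rpowSeries {s : ℝ} (hs : -(1 / 2) < s) (ha : EntireCoeff a) :
    MemLp (rpowSeries s a) 2 (volume.restrict (Ioo 0 1)) := by
  obtain ⟨C, hC, h⟩ := exists_abs_rpowSeries_le s ha
  refine ((memLp_rpow hs).const_mul C).mono ?_ ?_
  · exact ((contDiffOn_rpowSeries s ha).continuousOn.mono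
      (Ioo_subset_Ioi_self)).aestronglyMeasurable measurableSet_Ioo
  · filter_upwards [ae_restrict_mem measurableSet_Ioo] with x hx
    rw [Real.norm_eq_abs, Real.norm_eq_abs, abs_of_nonneg
      (mul_nonneg hC (Real.rpow_nonneg hx.1.le s))]
    exact h x ⟨hx.1, hx.2.le⟩

theorem tendsto_rpowSeries_zero {s : ℝ} (hs : 0 < s) (ha : EntireCoeff a) :
    Tendsto (rpowSeries s a) (𝓝[>] 0) (𝓝 0) := by
  have h : ContinuousAt (rpowSeries s a) 0 :=
    (Real.continuousAt_rpow_const 0 s (Or.inr hs.le)).mul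
      (ha.continuous.comp (continuous_pow 2)).continuousAt
  have h0 : rpowSeries s a 0 = 0 := by rw [rpowSeries, Real.zero_rpow hs.ne', zero_mul]
  rw [ContinuousAt, h0] at h
  exact h.mono_left nhdsWithin_le_nhds

end

/-! ### Bessel functions -/

/-- The coefficients of `√x J_μ(√E x)` as a generalized power series. -/
noncomputable def besselCoeff (μ E : ℝ) (k : ℕ) : ℝ :=
  (√E / 2) ^ μ * ((-(E / 4)) ^ k / ((k.factorial : ℝ) * Real.Gamma (k + μ + 1)))

/-- This recurrence is the Bessel equation at the level of coefficients. It comes from `Γ(z + 1) = z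
Γ(z)`; the bound `-1 < μ` keeps all Gamma arguments positive. -/
theorem besselCoeff_succ {μ : ℝ} (hμ : -1 < μ) (E : ℝ) (k : ℕ) :
    4 * ((k + 1) * (k + 1 + μ)) * besselCoeff μ E (k + 1) = -E * besselCoeff μ E k := by
  have hk : (0 : ℝ) ≤ k := k.cast_nonneg
  have h1 : 0 < (k : ℝ) + μ + 1 := by linarith
  have h2 : Real.Gamma ((k : ℝ) + 1 + μ + 1) = (k + μ + 1) * Real.Gamma (k + μ + 1) := by
    rw [← Real.Gamma_add_one h1.ne']
    congr 1
    ring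
  have h3 := (Real.Gamma_pos_of_pos h1).ne'
  have h4 : (k.factorial : ℝ) ≠ 0 := by positivity
  simp only [besselCoeff, Nat.factorial_succ, Nat.cast_mul, pow_succ, Nat.cast_add,
    Nat.cast_one, h2]
  have h5 : (k : ℝ) + 1 ≠ 0 := by positivity
  have h6 : (k : ℝ) + μ + 1 ≠ 0 := h1.ne'
  field_simp
  ring

/-- Ratio test: by the recurrence the ratio of consecutive terms is at most `|E| |r| / (4 k)`, which
is below `1 / 2` once `k ≥ |E| |r|`. -/
theorem entireCoeff_besselCoeff {μ : ℝ} (hμ : -1 < μ) (E : ℝ) : EntireCoeff (besselCoeff μ E) := by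
  intro r
  refine summable_of_ratio_norm_eventually_le (r := 1 / 2) (by norm_num) ?_
  obtain ⟨N, hN⟩ := exists_nat_ge (|E| * |r|)
  filter_upwards [eventually_ge_atTop (max N 1)] with k hk
  have hkN : |E| * |r| ≤ k := hN.trans (by exact_mod_cast (le_max_left N 1).trans hk)
  have hk1 : (1 : ℝ) ≤ k := by exact_mod_cast (le_max_right N 1).trans hk
  have h := congrArg abs (besselCoeff_succ hμ E k)
  have hD : (k : ℝ) ≤ (k + 1) * (k + 1 + μ) := by nlinarith
  have hD0 : (0 : ℝ) ≤ 4 * ((k + 1) * (k + 1 + μ)) := by linarith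
  rw [abs_mul, abs_of_nonneg hD0, abs_mul, abs_neg] at h
  simp only [norm_mul, norm_pow, Real.norm_eq_abs, pow_succ]
  set A := |besselCoeff μ E k|
  set B := |besselCoeff μ E (k + 1)|
  have hA : 0 ≤ A := abs_nonneg _
  have hB : 0 ≤ B := abs_nonneg _
  have h1 : 4 * k * (B * |r|) ≤ k * A := by
    calc 4 * k * (B * |r|) ≤ 4 * ((k + 1) * (k + 1 + μ)) * (B * |r|) :=
          mul_le_mul_of_nonneg_right (by linarith) (by positivity)
      _ = (|E| * |r|) * A := by rw [← mul_assoc, h]; ring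
      _ ≤ k * A := by gcongr
  have h2 : B * |r| ≤ 1 / 2 * A := by
    nlinarith
  calc B * (|r| ^ k * |r|) = B * |r| * |r| ^ k := by ring
    _ ≤ 1 / 2 * A * |r| ^ k := by gcongr
    _ = _ := by ring

/-- `√x J_μ(√E x)`, as a generalized power series. -/
noncomputable def besselSol (μ E x : ℝ) : ℝ := rpowSeries (μ + 1 / 2) (besselCoeff μ E) x

/-- The derivative of `besselSol`. -/
noncomputable def besselSolDeriv (μ E x : ℝ) : ℝ :=
  rpowSeries (μ + 1 / 2 - 1) (rpowDerivCoeff (μ + 1 / 2) (besselCoeff μ E)) x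

theorem besselSol_eq (μ : ℝ) {E : ℝ} (hE : 0 < E) {x : ℝ} (hx : 0 < x) :
    besselSol μ E x = √x * besselJ μ (√E * x) := by
  have hs : 0 < √E := Real.sqrt_pos.2 hE
  rw [besselSol, rpowSeries, powerSum, besselJ, ← tsum_mul_left, ← tsum_mul_left]
  refine tsum_congr fun k => ?_
  have h1 : (√E * x / 2) ^ (2 * (k : ℝ) + μ)
      = (E / 4) ^ k * x ^ (2 * k) * ((√E / 2) ^ μ * x ^ μ) := by
    rw [Real.rpow_add (by positivity), Real.rpow_mul (by positivity), Real.rpow_natCast,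
      Real.rpow_ofNat, mul_div_right_comm, Real.mul_rpow (by positivity) hx.le]
    rw [mul_pow, div_pow, Real.sq_sqrt hE.le, mul_pow, pow_mul x 2 k]
    norm_num
  rw [h1, Real.rpow_add hx, ← Real.sqrt_eq_rpow, besselCoeff, neg_pow (E / 4), ← pow_mul]
  ring

section

variable {μ : ℝ} (hμ : -1 < μ) (E : ℝ)
include hμ

theorem hasDerivAt_besselSol {x : ℝ} (hx : 0 < x) :
    HasDerivAt (besselSol μ E) (besselSolDeriv μ E x) x :=
  hasDerivAt_rpowSeries _ (entireCoeff_besselCoeff hμ E) hx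

/-- Two differentiations multiply the `k`-th coefficient by `(μ + 1/2 + 2k)(μ - 1/2 + 2k) = 4k(k +
μ) + (μ² - 1/4)`. The constant gives the potential; the rest vanishes at `k = 0` and, by the
recurrence, is `-E x²` times the original series. -/
theorem hasDerivAt_besselSolDeriv {x : ℝ} (hx : 0 < x) :
    HasDerivAt (besselSolDeriv μ E) (((μ ^ 2 - 1 / 4) / x ^ 2 - E) * besselSol μ E x) x := by
  have he := entireCoeff_besselCoeff hμ E
  refine (hasDerivAt_rpowSeries _ (he.rpowDerivCoeff _) hx).congr_deriv ?_
  have hs : x ^ (μ + 1 / 2) = x ^ (μ + 1 / 2 - 1 - 1) * x ^ 2 := by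
    rw [Real.rpow_sub_one hx.ne', Real.rpow_sub_one hx.ne']
    field_simp
  set b : ℕ → ℝ := fun k => 4 * (k * (k + μ)) * besselCoeff μ E k
  have hb : b = fun k => (rpowDerivCoeff (μ + 1 / 2 - 1) (rpowDerivCoeff (μ + 1 / 2)
      (besselCoeff μ E)) k) + (-(μ ^ 2 - 1 / 4)) * besselCoeff μ E k := by
    funext k
    simp only [b, rpowDerivCoeff]
    ring
  have hd := (he.rpowDerivCoeff (μ + 1 / 2)).rpowDerivCoeff (μ + 1 / 2 - 1)
  have h1 : powerSum b (x ^ 2) = powerSum (rpowDerivCoeff (μ + 1 / 2 - 1)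
      (rpowDerivCoeff (μ + 1 / 2) (besselCoeff μ E))) (x ^ 2)
      + (-(μ ^ 2 - 1 / 4)) * powerSum (besselCoeff μ E) (x ^ 2) := by
    rw [hb, powerSum_add hd (he.const_mul _), powerSum_const_mul]
  have hbe : EntireCoeff b := by
    rw [hb]
    exact hd.add (he.const_mul _)
  have h2 : powerSum b (x ^ 2) = x ^ 2 * (-E * powerSum (besselCoeff μ E) (x ^ 2)) := by
    rw [powerSum_eq_add_tail hbe]
    have : (fun k => b (k + 1)) = fun k => -E * besselCoeff μ E k := by
      funext k
      rw [← besselCoeff_succ hμ E k]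
      simp only [b]
      push_cast
      ring
    rw [this, powerSum_const_mul]
    simp [b]
  rw [h2] at h1
  rw [besselSol, rpowSeries, rpowSeries, hs]
  have h3 := eq_sub_of_add_eq h1.symm
  rw [h3]
  field_simp
  ring

end

/-! ### Leading coefficients and the Wronskian. -/

theorem besselCoeff_zero (μ E : ℝ) :
    besselCoeff μ E 0 = (√E / 2) ^ μ / Real.Gamma (μ + 1) := by
  simp [besselCoeff, div_eq_mul_inv]

theorem besselCoeff_zero_pos {μ : ℝ} (hμ : -1 < μ) {E : ℝ} (hE : 0 < E) :
    0 < besselCoeff μ E 0 := by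
  rw [besselCoeff_zero]
  have := Real.sqrt_pos.2 hE
  have := Real.Gamma_pos_of_pos (by linarith : 0 < μ + 1)
  positivity

/-- The Wronskian is constant because the equation has no first-order term. Its value is found at
the origin, where the powers of `x` cancel and only the leading coefficients survive: the factor is
`(-ν + 1/2) - (ν + 1/2) = -2ν`. -/
theorem wronskian_besselSol {ν : ℝ} (hν : ν ∈ Ioo (0 : ℝ) 1) (E : ℝ) {x : ℝ} (hx : 0 < x) :
    besselSol ν E x * besselSolDeriv (-ν) E x - besselSolDeriv ν E x * besselSol (-ν) E x
      = -2 * ν * (besselCoeff ν E 0 * besselCoeff (-ν) E 0) := by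
  have hp : -1 < ν := by linarith [hν.1]
  have hm : -1 < -ν := by linarith [hν.2]
  set W : ℝ → ℝ := fun x =>
    besselSol ν E x * besselSolDeriv (-ν) E x - besselSolDeriv ν E x * besselSol (-ν) E x
  have hW : ∀ y ∈ Ioi (0 : ℝ), HasDerivAt W 0 y := by
    intro y hy
    refine (((hasDerivAt_besselSol hp E hy).mul (hasDerivAt_besselSolDeriv hm E hy)).sub
      ((hasDerivAt_besselSolDeriv hp E hy).mul (hasDerivAt_besselSol hm E hy))).congr_deriv ?_
    ring
  have hc : ∀ y ∈ Ioi (0 : ℝ), W y = W x := fun y hy =>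
    isOpen_Ioi.is_const_of_deriv_eq_zero (isPreconnected_Ioi)
      (fun z hz => (hW z hz).differentiableAt.differentiableWithinAt)
      (fun z hz => (hW z hz).deriv) hy hx
  have hlim : Tendsto W (𝓝[>] 0) (𝓝 (W x)) :=
    tendsto_const_nhds.congr' (by
      filter_upwards [self_mem_nhdsWithin] with y hy using (hc y hy).symm)
  have ep := entireCoeff_besselCoeff hp E
  have em := entireCoeff_besselCoeff hm E
  -- The Wronskian with the powers of `y` cancelled, which is continuous up to `0`.
  set V : ℝ → ℝ := fun y =>
    powerSum (besselCoeff ν E) (y ^ 2)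
      * powerSum (rpowDerivCoeff (-ν + 1 / 2) (besselCoeff (-ν) E)) (y ^ 2)
    - powerSum (rpowDerivCoeff (ν + 1 / 2) (besselCoeff ν E)) (y ^ 2)
      * powerSum (besselCoeff (-ν) E) (y ^ 2)
  have hV : Continuous V :=
    ((ep.continuous.comp (continuous_pow 2)).mul
      ((em.rpowDerivCoeff _).continuous.comp (continuous_pow 2))).sub
    (((ep.rpowDerivCoeff _).continuous.comp (continuous_pow 2)).mul
      (em.continuous.comp (continuous_pow 2)))
  have hVW : ∀ y ∈ Ioi (0 : ℝ), V y = W y := by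
    intro y hy
    have e1 : y ^ (ν + 1 / 2) * y ^ (-ν + 1 / 2 - 1) = 1 := by
      rw [← Real.rpow_add hy]; ring_nf; exact Real.rpow_zero y
    have e2 : y ^ (ν + 1 / 2 - 1) * y ^ (-ν + 1 / 2) = 1 := by
      rw [← Real.rpow_add hy]; ring_nf; exact Real.rpow_zero y
    simp only [W, V, besselSol, besselSolDeriv, rpowSeries]
    rw [mul_mul_mul_comm, e1, mul_mul_mul_comm, e2, one_mul, one_mul]
  have hlim' : Tendsto W (𝓝[>] 0) (𝓝 (V 0)) :=
    (hV.tendsto 0 |>.mono_left nhdsWithin_le_nhds).congr' (by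
      filter_upwards [self_mem_nhdsWithin] with y hy using hVW y hy)
  refine (tendsto_nhds_unique hlim hlim').trans ?_
  simp only [V, ne_eq, OfNat.ofNat_ne_zero, not_false_eq_true, zero_pow, powerSum_zero,
    rpowDerivCoeff, Nat.cast_zero]
  ring

theorem wronskian_besselSol_ne_zero {ν : ℝ} (hν : ν ∈ Ioo (0 : ℝ) 1) {E : ℝ} (hE : 0 < E) {x : ℝ}
    (hx : 0 < x) :
    besselSol ν E x * besselSolDeriv (-ν) E x - besselSolDeriv ν E x * besselSol (-ν) E x ≠ 0 := by
  rw [wronskian_besselSol hν E hx]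
  have h1 := besselCoeff_zero_pos (by linarith [hν.1] : -1 < ν) hE
  have h2 := besselCoeff_zero_pos (by linarith [hν.2] : -1 < -ν) hE
  have h3 := hν.1
  have : 0 < ν * (besselCoeff ν E 0 * besselCoeff (-ν) E 0) := by positivity
  intro h
  linarith

/-- Lebesgue measure on `(0, 1)`. -/
noncomputable abbrev volHalf : Measure ℝ := volume.restrict (Ioo (0 : ℝ) 1)

/-! ### Integration by parts against test functions -/

theorem IsTest.continuous_mul {U : Set ℝ} (hU : IsOpen U) {φ g : ℝ → ℝ} (hφ : IsTest U φ)
    (hg : ContinuousOn g U) : Continuous (fun x => g x * φ x) :=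
  (hg.mul hφ.1.continuous.continuousOn).continuous_of_tsupport_subset hU
    (tsupport_mul_subset_right.trans hφ.2.2)

theorem IsTest.integrable_mul {U : Set ℝ} (hU : IsOpen U) {φ g : ℝ → ℝ} (hφ : IsTest U φ)
    (hg : ContinuousOn g U) : Integrable (fun x => g x * φ x) :=
  (hφ.continuous_mul hU hg).integrable_of_hasCompactSupport hφ.2.1.mul_left

theorem IsTest.eq_zero {U : Set ℝ} {φ : ℝ → ℝ} (hφ : IsTest U φ) {x : ℝ} (hx : x ∉ U) : φ x = 0 :=
  image_eq_zero_of_notMem_tsupport fun h => hx (hφ.2.2 h)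

theorem setIntegral_mul_eq {U V : Set ℝ} {φ : ℝ → ℝ} (hφ : IsTest U φ) (hUV : U ⊆ V)
    (g : ℝ → ℝ) : ∫ x in V, g x * φ x = ∫ x, g x * φ x :=
  setIntegral_eq_integral_of_forall_compl_eq_zero fun x hx => by
    rw [hφ.eq_zero fun h => hx (hUV h), mul_zero]

/-- `F φ` extends by zero to a function differentiable on the whole line, so the integral of its
derivative is zero, whatever `F` does outside `U`. -/
theorem IsTest.integral_mul_deriv {U : Set ℝ} (hU : IsOpen U) {φ F F' : ℝ → ℝ} (hφ : IsTest U φ)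
    (hF : ∀ x ∈ U, HasDerivAt F (F' x) x) (hF' : ContinuousOn F' U) :
    ∫ x, F x * deriv φ x = -∫ x, F' x * φ x := by
  have hFc : ContinuousOn F U := fun x hx => (hF x hx).continuousAt.continuousWithinAt
  have i1 := hφ.integrable_mul hU hF'
  have i2 := (isTest_deriv hφ).integrable_mul hU hFc
  have hd : ∀ x, HasDerivAt (fun x => F x * φ x) (F' x * φ x + F x * deriv φ x) x := by
    intro x
    by_cases hx : x ∈ tsupport φ
    · exact (hF x (hφ.2.2 hx)).mul ((hφ.1.differentiable (by simp)) x).hasDerivAt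
    · have h0 : φ =ᶠ[𝓝 x] 0 := notMem_tsupport_iff_eventuallyEq.1 hx
      have h1 : deriv φ x = 0 := by rw [h0.deriv_eq]; simp
      have h2 : (fun x => F x * φ x) =ᶠ[𝓝 x] fun _ => 0 := by
        filter_upwards [h0] with y hy
        simp [hy]
      rw [h0.eq_of_nhds, h1]
      simpa using (hasDerivAt_const x (0 : ℝ)).congr_of_eventuallyEq h2
  have h := integral_eq_zero_of_hasDerivAt_of_integrable hd (i1.add i2)
    (hφ.integrable_mul hU hFc)
  rw [integral_add i1 i2] at h
  linarith

/-- Transfers a limit from one representative to a continuous one: the points near `c` where `F`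
leaves a closed neighbourhood of `A` form an open null set, hence none exist. -/
theorem tendsto_of_ae_eq_of_continuousOn {a b c A : ℝ} {F v : ℝ → ℝ}
    (hF : ContinuousOn F (Ioo a b)) (hae : F =ᵐ[volume.restrict (Ioo a b)] v)
    (hv : Tendsto v (𝓝[Ioo a b] c) (𝓝 A)) : Tendsto F (𝓝[Ioo a b] c) (𝓝 A) := by
  refine (closed_nhds_basis A).tendsto_right_iff.2 fun V hV => ?_
  obtain ⟨O, hO, hcO, hOV⟩ := mem_nhdsWithin.1 (hv hV.1)
  refine mem_nhdsWithin.2 ⟨O, hO, hcO, ?_⟩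
  have hopen : IsOpen (O ∩ (Ioo a b ∩ F ⁻¹' Vᶜ)) :=
    hO.inter (hF.isOpen_inter_preimage isOpen_Ioo hV.2.isOpen_compl)
  have hnull : volume (O ∩ (Ioo a b ∩ F ⁻¹' Vᶜ)) = 0 := by
    rw [EventuallyEq, ae_restrict_iff' measurableSet_Ioo] at hae
    refine measure_mono_null (fun x hx => ?_) (ae_iff.1 hae)
    rw [mem_ofPred_eq]
    intro h
    exact hx.2.2 (by rw [h hx.2.1]; exact hOV ⟨hx.1, hx.2.1⟩)
  have hempty := (hopen.measure_eq_zero_iff volume).1 hnull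
  intro x hx
  by_contra hxV
  exact (Set.eq_empty_iff_forall_notMem.1 hempty x) ⟨hx.1, hx.2, hxV⟩

/-! ### Weak solutions on a half-interval -/

theorem exists_Ioo_of_isCompact_subset {K : Set ℝ} (hK : IsCompact K) {a b : ℝ} (hab : a < b)
    (h : K ⊆ Ioo a b) : ∃ α β, a < α ∧ α < β ∧ β < b ∧ K ⊆ Ioo α β := by
  -- The midpoint is added so that the extremal points exist even when `K` is empty.
  have hne : (insert ((a + b) / 2) K).Nonempty := insert_nonempty _ _
  have hsub : insert ((a + b) / 2) K ⊆ Ioo a b :=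
    insert_subset ⟨by linarith, by linarith⟩ h
  obtain ⟨m, hm, hm'⟩ := (hK.insert ((a + b) / 2)).exists_isLeast hne
  obtain ⟨M, hM, hM'⟩ := (hK.insert ((a + b) / 2)).exists_isGreatest hne
  have h1 := hsub hm
  have h2 := hsub hM
  have h3 : m ≤ M := hm' hM
  refine ⟨(a + m) / 2, (b + M) / 2, by linarith [h1.1], by linarith [h1.1, h2.2],
    by linarith [h2.2], fun x hx => ?_⟩
  have h4 := hm' (mem_insert_of_mem _ hx)
  have h5 := hM' (mem_insert_of_mem _ hx)
  exact ⟨by linarith [h1.1], by linarith [h2.2]⟩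

theorem IsTest.contDiff_mul {U : Set ℝ} (hU : IsOpen U) {φ g : ℝ → ℝ} (hφ : IsTest U φ)
    (hg : ContDiffOn ℝ ∞ g U) : ContDiff ℝ ∞ (fun x => g x * φ x) := by
  refine contDiff_iff_contDiffAt.2 fun x => ?_
  by_cases hx : x ∈ tsupport φ
  · exact (hg.contDiffAt (hU.mem_nhds (hφ.2.2 hx))).mul hφ.1.contDiffAt
  · refine (contDiffAt_const (c := (0 : ℝ))).congr_of_eventuallyEq ?_
    filter_upwards [notMem_tsupport_iff_eventuallyEq.1 hx] with y hy
    simp [hy]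

theorem contDiff_primitive {g : ℝ → ℝ} (hg : ContDiff ℝ ∞ g) (a : ℝ) :
    ContDiff ℝ ∞ (fun x => ∫ t in a..x, g t) := by
  have hd : ∀ x, HasDerivAt (fun x => ∫ t in a..x, g t) (g x) x := fun x =>
    hg.continuous.integral_hasStrictDerivAt a x |>.hasDerivAt
  refine contDiff_infty_iff_deriv.2 ⟨fun x => (hd x).differentiableAt, ?_⟩
  rwa [funext fun x => (hd x).deriv]

section

variable {ν : ℝ} (hν : ν ∈ Ioo (0 : ℝ) 1) (E : ℝ)
include hν

theorem contDiffOn_besselSol : ContDiffOn ℝ ∞ (besselSol ν E) (Ioi 0) :=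
  contDiffOn_rpowSeries _ (entireCoeff_besselCoeff (by linarith [hν.1]) E)

theorem contDiffOn_besselSol_neg : ContDiffOn ℝ ∞ (besselSol (-ν) E) (Ioi 0) :=
  contDiffOn_rpowSeries _ (entireCoeff_besselCoeff (by linarith [hν.2]) E)

theorem memLp_besselSol : MemLp (besselSol ν E) 2 volHalf :=
  memLp_rpowSeries (by linarith [hν.1]) (entireCoeff_besselCoeff (by linarith [hν.1]) E)

theorem memLp_besselSol_neg : MemLp (besselSol (-ν) E) 2 volHalf :=
  memLp_rpowSeries (by linarith [hν.2]) (entireCoeff_besselCoeff (by linarith [hν.2]) E)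

/-- Variation of constants: a test function orthogonal to the solutions of the homogeneous equation
is in the image of the test functions. -/
theorem exists_isTest_of_integral_eq_zero {E : ℝ} (hE : 0 < E) {ψ : ℝ → ℝ}
    (hψ : IsTest (Ioo 0 1) ψ) (h1 : ∫ x, besselSol ν E x * ψ x = 0)
    (h2 : ∫ x, besselSol (-ν) E x * ψ x = 0) :
    ∃ φ, IsTest (Ioo 0 1) φ ∧ ∀ x ∈ Ioo (0 : ℝ) 1,
      -deriv (deriv φ) x + (ν ^ 2 - 1 / 4) / x ^ 2 * φ x - E * φ x = ψ x := by
  have hp : -1 < ν := by linarith [hν.1]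
  have hm : -1 < -ν := by linarith [hν.2]
  obtain ⟨α, β, hα, hαβ, hβ, hK⟩ := exists_Ioo_of_isCompact_subset hψ.2.1 one_pos hψ.2.2
  set u := besselSol ν E with hu
  set v := besselSol (-ν) E with hv
  set W := -2 * ν * (besselCoeff ν E 0 * besselCoeff (-ν) E 0) with hW
  have hWx : ∀ x, 0 < x → u x * besselSolDeriv (-ν) E x - besselSolDeriv ν E x * v x = W :=
    fun x hx => wronskian_besselSol hν E hx
  have hW0 : W ≠ 0 := by
    rw [← hWx 1 one_pos]
    exact wronskian_besselSol_ne_zero hν hE one_pos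
  have su := hψ.contDiff_mul isOpen_Ioo
    ((contDiffOn_besselSol hν E).mono (Ioo_subset_Ioi_self : Ioo (0 : ℝ) 1 ⊆ Ioi 0))
  have sv := hψ.contDiff_mul isOpen_Ioo
    ((contDiffOn_besselSol_neg hν E).mono (Ioo_subset_Ioi_self : Ioo (0 : ℝ) 1 ⊆ Ioi 0))
  -- The primitive vanishes to the left of the support of `ψ` trivially, and to its right because of
  -- the orthogonality to `g`. This is what makes `φ` compactly supported.
  have hzero : ∀ g : ℝ → ℝ, (∫ x, g x * ψ x = 0) → ∀ x, x ∉ Ioo α β →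
      ∫ t in (0 : ℝ)..x, g t * ψ t = 0 := by
    intro g hg x hx
    have hψ0 : ∀ t, t ∉ Ioo α β → ψ t = 0 := fun t ht =>
      image_eq_zero_of_notMem_tsupport fun h => ht (hK h)
    rcases le_or_gt x α with hxα | hxα
    · refine intervalIntegral.integral_zero_ae (Eventually.of_forall fun t ht => ?_)
      have : t ≤ α := (mem_uIoc.1 ht).elim (fun h => h.2.trans hxα) (fun h => by linarith [h.2])
      rw [hψ0 t fun h => absurd h.1 this.not_gt, mul_zero]
    · have hxβ : β ≤ x := not_lt.1 fun h => hx ⟨hxα, h⟩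
      rw [intervalIntegral.integral_eq_integral_of_support_subset, hg]
      intro t ht
      have : t ∈ Ioo α β := by
        by_contra h
        exact ht (by simp [hψ0 t h])
      exact ⟨hα.trans this.1, this.2.le.trans hxβ⟩
  set U : ℝ → ℝ := fun x => ∫ t in (0 : ℝ)..x, u t * ψ t with hUdef
  set V : ℝ → ℝ := fun x => ∫ t in (0 : ℝ)..x, v t * ψ t with hVdef
  have dU : ∀ x, HasDerivAt U (u x * ψ x) x := fun x =>
    (su.continuous.integral_hasStrictDerivAt 0 x).hasDerivAt
  have dV : ∀ x, HasDerivAt V (v x * ψ x) x := fun x =>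
    (sv.continuous.integral_hasStrictDerivAt 0 x).hasDerivAt
  -- The variation of constants formula. In `φ'` the terms containing `ψ` cancel; in `φ''` they
  -- produce `-ψ` through the Wronskian.
  set φ : ℝ → ℝ := fun x => (u x * V x - v x * U x) / W with hφ
  have hφ0 : ∀ x, x ∉ Ioo α β → φ x = 0 := fun x hx => by
    simp only [φ, U, V, hzero u h1 x hx, hzero v h2 x hx]
    simp
  have hsupp : tsupport φ ⊆ Icc α β :=
    closure_minimal (fun x hx => Ioo_subset_Icc_self (by
      by_contra h
      exact hx (hφ0 x h))) isClosed_Icc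
  have hφs : ContDiff ℝ ∞ φ := by
    refine contDiff_iff_contDiffAt.2 fun x => ?_
    rcases lt_or_ge x α with hx | hx
    · refine (contDiffAt_const (c := (0 : ℝ))).congr_of_eventuallyEq ?_
      filter_upwards [Iio_mem_nhds hx] with y hy
      exact hφ0 y fun h => absurd h.1 (not_lt.2 (le_of_lt hy))
    · have hx0 : Ioi (0 : ℝ) ∈ 𝓝 x := Ioi_mem_nhds (hα.trans_le hx)
      exact ((((contDiffOn_besselSol hν E).contDiffAt hx0).mul
        (contDiff_primitive sv 0).contDiffAt).sub
        (((contDiffOn_besselSol_neg hν E).contDiffAt hx0).mul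
        (contDiff_primitive su 0).contDiffAt)).div_const W
  refine ⟨φ, ⟨hφs, isCompact_Icc.of_isClosed_subset (isClosed_tsupport _) hsupp,
    hsupp.trans (Icc_subset_Ioo hα hβ)⟩, fun x hx => ?_⟩
  have d1 : ∀ y ∈ Ioi (0 : ℝ), HasDerivAt φ
      ((besselSolDeriv ν E y * V y - besselSolDeriv (-ν) E y * U y) / W) y := by
    intro y hy
    refine ((((hasDerivAt_besselSol hp E hy).mul (dV y)).sub
      ((hasDerivAt_besselSol hm E hy).mul (dU y))).div_const W).congr_deriv ?_
    simp only [← hu, ← hv]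
    ring
  have d2 : deriv φ =ᶠ[𝓝 x]
      fun y => (besselSolDeriv ν E y * V y - besselSolDeriv (-ν) E y * U y) / W := by
    filter_upwards [Ioi_mem_nhds hx.1] with y hy using (d1 y hy).deriv
  have d3 := ((((hasDerivAt_besselSolDeriv hp E hx.1).mul (dV x)).sub
      ((hasDerivAt_besselSolDeriv hm E hx.1).mul (dU x))).div_const W).deriv
  have d4 : deriv (deriv φ) x = _ := d2.deriv_eq.trans d3
  rw [d4]
  have hw := hWx x hx.1
  simp only [φ, ← hu, ← hv]
  field_simp
  rw [← hw]
  ring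

/-- Weak solutions of the eigenvalue equation on `(0, 1)` are combinations of Bessel functions. -/
theorem exists_eq_besselSol_of_weak {E : ℝ} (hE : 0 < E) {f : ℝ → ℝ} (hf : Integrable f volHalf)
    (h : ∀ φ, IsTest (Ioo 0 1) φ →
      ∫ x, f x * (-deriv (deriv φ) x + (ν ^ 2 - 1 / 4) / x ^ 2 * φ x - E * φ x) ∂volHalf = 0) :
    ∃ a b : ℝ, ∀ᵐ x ∂volHalf, f x = a * besselSol ν E x + b * besselSol (-ν) E x := by
  let T : Submodule ℝ (ℝ → ℝ) :=
    { carrier := {φ | IsTest (Ioo 0 1) φ}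
      zero_mem' := ⟨contDiff_const, HasCompactSupport.zero, by simp⟩
      add_mem' := fun {φ ψ} hφ hψ => ⟨hφ.1.add hψ.1, hφ.2.1.add hψ.2.1,
        (tsupport_add φ ψ).trans (union_subset hφ.2.2 hψ.2.2)⟩
      smul_mem' := fun c φ hφ => ⟨hφ.1.const_smul c, hφ.2.1.smul_left,
        (tsupport_smul_subset_right (fun _ => c) φ).trans hφ.2.2⟩ }
  have hint : ∀ g : ℝ → ℝ, Integrable g volHalf → ∀ φ : T,
      Integrable (fun x => g x * (φ : ℝ → ℝ) x) volHalf := by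
    intro g hg φ
    obtain ⟨C, hC⟩ := φ.2.2.1.exists_bound_of_continuous φ.2.1.continuous
    exact hg.mul_bdd (c := C) φ.2.1.continuous.aestronglyMeasurable (Eventually.of_forall hC)
  let ℓ : ∀ g : ℝ → ℝ, Integrable g volHalf → (T →ₗ[ℝ] ℝ) := fun g hg =>
    { toFun := fun φ => ∫ x, g x * (φ : ℝ → ℝ) x ∂volHalf
      map_add' := fun φ ψ => by
        rw [← integral_add (hint g hg φ) (hint g hg ψ)]
        exact integral_congr_ae (Eventually.of_forall fun x => mul_add _ _ _)
      map_smul' := fun c φ => by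
        rw [RingHom.id_apply, smul_eq_mul, ← integral_const_mul]
        exact integral_congr_ae (Eventually.of_forall fun x => mul_left_comm _ _ _) }
  have iu : Integrable (besselSol ν E) volHalf :=
    (memLp_besselSol hν E).integrable (by norm_num)
  have iv : Integrable (besselSol (-ν) E) volHalf :=
    (memLp_besselSol_neg hν E).integrable (by norm_num)
  -- A linear functional that vanishes on the common kernel of finitely many others is a combination
  -- of them; no topology on the test functions is needed.
  have hspan : ℓ f hf ∈ Submodule.span ℝ (range ![ℓ _ iu, ℓ _ iv]) := by
    refine mem_span_of_iInf_ker_le_ker fun ψ hψ => ?_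
    simp only [Submodule.mem_iInf, Fin.forall_fin_two, Matrix.cons_val_zero, Matrix.cons_val_one,
      LinearMap.mem_ker] at hψ
    have e1 : ∫ x, besselSol ν E x * (ψ : ℝ → ℝ) x = 0 := by
      rw [← setIntegral_mul_eq ψ.2 subset_rfl]; exact hψ.1
    have e2 : ∫ x, besselSol (-ν) E x * (ψ : ℝ → ℝ) x = 0 := by
      rw [← setIntegral_mul_eq ψ.2 subset_rfl]; exact hψ.2
    obtain ⟨φ, hφ, hφψ⟩ := exists_isTest_of_integral_eq_zero hν hE ψ.2 e1 e2
    rw [LinearMap.mem_ker]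
    refine Eq.trans (integral_congr_ae ?_) (h φ hφ)
    filter_upwards [ae_restrict_mem measurableSet_Ioo] with x hx
    rw [hφψ x hx]
  simp only [Matrix.range_cons, Matrix.range_empty, union_empty, singleton_union,
    Submodule.mem_span_pair] at hspan
  obtain ⟨a, b, hab⟩ := hspan
  refine ⟨a, b, ?_⟩
  have ig := hf.sub ((iu.const_mul a).add (iv.const_mul b))
  have := isOpen_Ioo.ae_eq_zero_of_integral_contDiff_smul_eq_zero (U := Ioo (0 : ℝ) 1)
    (ig.locallyIntegrable.locallyIntegrableOn _) fun φ k1 k2 k3 => ?_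
  · filter_upwards [this, ae_restrict_mem measurableSet_Ioo] with x hx hm
    have := hx hm
    simp only [Pi.sub_apply, Pi.add_apply] at this
    linarith
  · let φ' : T := ⟨φ, k1, k2, k3⟩
    have h1 := LinearMap.congr_fun hab φ'
    have h2 : a * ∫ x, besselSol ν E x * φ x ∂volHalf
        + b * ∫ x, besselSol (-ν) E x * φ x ∂volHalf = ∫ x, f x * φ x ∂volHalf := h1
    have j0 := hint f hf φ'
    have j1 := (hint _ iu φ').const_mul a
    have j2 := (hint _ iv φ').const_mul b
    rw [← integral_const_mul, ← integral_const_mul] at h2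
    have h3 := integral_sub j0 (j1.add j2)
    have h4 := integral_add j1 j2
    refine Eq.trans (integral_congr_ae (Eventually.of_forall fun x => ?_))
      (h3.trans (by
        rw [sub_eq_zero]
        exact h2.symm.trans h4.symm))
    simp only [Pi.sub_apply, Pi.add_apply, smul_eq_mul, φ']
    ring

end

/-! ### Behaviour at the origin -/

/-- Both `h₁` and `F₁` are weak derivatives of the same function, so their difference annihilates
every test function on `(0, 1)`. -/
theorem ae_eq_of_weak_deriv {h h₁ F F₁ : ℝ → ℝ} (hh₁ : Integrable h₁ volHalf)
    (hw : ∀ φ, IsTest (Ioo 0 1) φ →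
      ∫ x, h x * deriv φ x ∂volHalf = -∫ x, h₁ x * φ x ∂volHalf)
    (hF : ∀ x ∈ Ioo (0 : ℝ) 1, HasDerivAt F (F₁ x) x) (hF₁ : ContinuousOn F₁ (Ioo 0 1))
    (hhF : h =ᵐ[volHalf] F) : h₁ =ᵐ[volHalf] F₁ := by
  have hl : LocallyIntegrableOn (fun x => h₁ x - F₁ x) (Ioo 0 1) volHalf :=
    (hh₁.locallyIntegrable.locallyIntegrableOn _).sub
      (hF₁.locallyIntegrableOn measurableSet_Ioo)
  have := isOpen_Ioo.ae_eq_zero_of_integral_contDiff_smul_eq_zero hl fun φ k1 k2 k3 => ?_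
  · filter_upwards [this, ae_restrict_mem measurableSet_Ioo] with x hx hm
    exact sub_eq_zero.1 (hx hm)
  · have hφ : IsTest (Ioo 0 1) φ := ⟨k1, k2, k3⟩
    have e1 := hw φ hφ
    have e2 := hφ.integral_mul_deriv isOpen_Ioo hF hF₁
    have e3 : ∫ x, h x * deriv φ x ∂volHalf = ∫ x, F x * deriv φ x ∂volHalf :=
      integral_congr_ae (by filter_upwards [hhF] with x hx; rw [hx])
    rw [← setIntegral_mul_eq (isTest_deriv hφ) subset_rfl, ← setIntegral_mul_eq hφ subset_rfl] at e2
    obtain ⟨C, hC⟩ := k2.exists_bound_of_continuous k1.continuous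
    have i1 : Integrable (fun x => h₁ x * φ x) volHalf :=
      hh₁.mul_bdd (c := C) k1.continuous.aestronglyMeasurable (Eventually.of_forall hC)
    have i2 := (hφ.integrable_mul isOpen_Ioo hF₁).restrict (s := Ioo 0 1)
    have e4 := integral_sub i1 i2
    refine Eq.trans (integral_congr_ae (Eventually.of_forall fun x => ?_)) (e4.trans (by linarith))
    simp only [smul_eq_mul]
    ring

/-- Second-order vanishing of an `H²` function, quantitatively: a square-integrable `F₂` gives `F₁ =
O(√x)`, and the mean value inequality then gives `F = O(x^{3/2})`. Estimates are made from `ε > 0`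
and passed to the limit. -/
theorem exists_abs_le_of_hasDerivAt {F F₁ F₂ : ℝ → ℝ}
    (hF : ∀ x ∈ Ioo (0 : ℝ) 1, HasDerivAt F (F₁ x) x)
    (hF₁ : ∀ x ∈ Ioo (0 : ℝ) 1, HasDerivAt F₁ (F₂ x) x)
    (hF₂ : ContinuousOn F₂ (Ioo 0 1)) (hL : MemLp F₂ 2 volHalf)
    (l0 : Tendsto F (𝓝[Ioo 0 1] 0) (𝓝 0)) (l1 : Tendsto F₁ (𝓝[Ioo 0 1] 0) (𝓝 0)) :
    ∃ C, ∀ x ∈ Ioo (0 : ℝ) 1, |F x| ≤ C * (x * √x) := by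
  have hnb : (𝓝[Ioo (0 : ℝ) 1] 0).NeBot := by
    rw [nhdsWithin_Ioo_eq_nhdsGT one_pos]; infer_instance
  have hsq : IntegrableOn (fun x => F₂ x ^ 2) (Ioo 0 1) :=
    (memLp_two_iff_integrable_sq hL.1).1 hL
  set M := ∫ x in Ioo (0 : ℝ) 1, F₂ x ^ 2
  have hM : 0 ≤ M := integral_nonneg fun x => sq_nonneg _
  set C := (M + 1) / 2
  have hC : 0 ≤ C := by positivity
  have b1 : ∀ x ∈ Ioo (0 : ℝ) 1, |F₁ x| ≤ C * √x := by
    intro x hx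
    have hsx : 0 < √x := Real.sqrt_pos.2 hx.1
    have key : ∀ ε ∈ Ioo (0 : ℝ) x, |F₁ x - F₁ ε| ≤ C * √x := by
      intro ε hε
      have hsub : Icc ε x ⊆ Ioo 0 1 := fun t ht => ⟨hε.1.trans_le ht.1, ht.2.trans_lt hx.2⟩
      have hc : ContinuousOn F₂ (uIcc ε x) := by
        rw [uIcc_of_le hε.2.le]; exact hF₂.mono hsub
      have hI := intervalIntegral.integral_eq_sub_of_hasDerivAt (a := ε) (b := x) (f := F₁)
        (f' := F₂) (fun t ht => hF₁ t (hsub (by rwa [uIcc_of_le hε.2.le] at ht)))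
        hc.intervalIntegrable
      rw [← hI]
      -- A weighted arithmetic-geometric inequality in place of Cauchy-Schwarz. With weight `√x`,
      -- integration over an interval of length at most `x` gives `(M + 1) / 2 * √x`, whence the
      -- choice of `C`.
      have hb : ∀ t, |F₂ t| ≤ √x / 2 * F₂ t ^ 2 + 1 / (2 * √x) := by
        intro t
        have : 0 ≤ (√x * |F₂ t| - 1) ^ 2 / (2 * √x) := by positivity
        have e : (√x * |F₂ t| - 1) ^ 2 / (2 * √x)
            = √x / 2 * |F₂ t| ^ 2 + 1 / (2 * √x) - |F₂ t| := by
          field_simp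
          ring
        rw [e, sq_abs] at this
        linarith
      have hcs : IntervalIntegrable (fun t => F₂ t ^ 2) volume ε x :=
        (hc.pow 2).intervalIntegrable
      calc |∫ t in ε..x, F₂ t| ≤ ∫ t in ε..x, |F₂ t| :=
            intervalIntegral.abs_integral_le_integral_abs hε.2.le
        _ ≤ ∫ t in ε..x, (√x / 2 * F₂ t ^ 2 + 1 / (2 * √x)) :=
            intervalIntegral.integral_mono_on hε.2.le hc.abs.intervalIntegrable
              ((hcs.const_mul _).add intervalIntegrable_const) fun t _ => hb t
        _ = √x / 2 * (∫ t in ε..x, F₂ t ^ 2) + (x - ε) * (1 / (2 * √x)) := by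
            rw [intervalIntegral.integral_add (hcs.const_mul _) intervalIntegrable_const,
              intervalIntegral.integral_const_mul, intervalIntegral.integral_const, smul_eq_mul]
        _ ≤ √x / 2 * M + x * (1 / (2 * √x)) := by
            have : ∫ t in ε..x, F₂ t ^ 2 ≤ M := by
              rw [intervalIntegral.integral_of_le hε.2.le]
              exact setIntegral_mono_set hsq (Eventually.of_forall fun t => sq_nonneg _)
                (Ioc_subset_Icc_self.trans hsub).eventuallyLE
            have h2 : x - ε ≤ x := by linarith [hε.1]
            gcongr
        _ = C * √x := by
            have : x * (1 / (2 * √x)) = √x / 2 := by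
              nth_rewrite 1 [← Real.mul_self_sqrt hx.1.le]
              field_simp
            rw [this]
            ring
    have hlim : Tendsto (fun ε => |F₁ x - F₁ ε|) (𝓝[Ioo 0 1] 0) (𝓝 |F₁ x - 0|) :=
      (l1.const_sub _).abs
    rw [sub_zero] at hlim
    refine le_of_tendsto hlim ?_
    filter_upwards [mem_nhdsWithin_of_mem_nhds (Iio_mem_nhds hx.1), self_mem_nhdsWithin]
      with ε h1 h2 using key ε ⟨h2.1, h1⟩
  refine ⟨C, fun x hx => ?_⟩
  have key : ∀ ε ∈ Ioo (0 : ℝ) x, |F x - F ε| ≤ C * (x * √x) := by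
    intro ε hε
    have h := (convex_Icc ε x).norm_image_sub_le_of_norm_hasDerivWithin_le (f := F) (f' := F₁)
      (C := C * √x) (fun t ht => (hF t ⟨hε.1.trans_le ht.1, ht.2.trans_lt hx.2⟩).hasDerivWithinAt)
      (fun t ht => (b1 t ⟨hε.1.trans_le ht.1, ht.2.trans_lt hx.2⟩).trans
        (mul_le_mul_of_nonneg_left (Real.sqrt_le_sqrt ht.2) hC))
      (left_mem_Icc.2 hε.2.le) (right_mem_Icc.2 hε.2.le)
    rw [Real.norm_eq_abs, Real.norm_eq_abs, abs_of_pos (sub_pos.2 hε.2)] at h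
    refine h.trans ?_
    have : x - ε ≤ x := by linarith [hε.1]
    calc C * √x * (x - ε) ≤ C * √x * x := by gcongr
      _ = _ := by ring
  have hlim : Tendsto (fun ε => |F x - F ε|) (𝓝[Ioo 0 1] 0) (𝓝 |F x - 0|) :=
    (l0.const_sub _).abs
  rw [sub_zero] at hlim
  refine le_of_tendsto hlim ?_
  filter_upwards [mem_nhdsWithin_of_mem_nhds (Iio_mem_nhds hx.1), self_mem_nhdsWithin]
    with ε h1 h2 using key ε ⟨h2.1, h1⟩

/-- For `0 < ν < 1` both exponents are below `3/2`. Dividing by the smaller power `x^{-ν + 1/2}` and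
letting `x → 0` kills `q`; dividing by the other one then kills `p`. -/
theorem eq_zero_of_abs_le {ν p q C : ℝ} (hν : ν ∈ Ioo (0 : ℝ) 1)
    (h : ∀ x ∈ Ioo (0 : ℝ) 1, |p * x ^ (ν + 1 / 2) + q * x ^ (-ν + 1 / 2)| ≤ C * (x * √x)) :
    p = 0 ∧ q = 0 := by
  have hnb : (𝓝[Ioo (0 : ℝ) 1] 0).NeBot := by
    rw [nhdsWithin_Ioo_eq_nhdsGT one_pos]; infer_instance
  have hlim : ∀ s : ℝ, 0 < s → Tendsto (fun x : ℝ => x ^ s) (𝓝[Ioo 0 1] 0) (𝓝 0) := by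
    intro s hs
    have := (Real.continuousAt_rpow_const 0 s (Or.inr hs.le)).tendsto
    rw [Real.zero_rpow hs.ne'] at this
    exact this.mono_left nhdsWithin_le_nhds
  have h32 : ∀ x : ℝ, 0 < x → x * √x = x ^ (3 / 2 : ℝ) := by
    intro x hx
    rw [Real.sqrt_eq_rpow, ← Real.rpow_one_add' hx.le (by norm_num)]
    norm_num
  have hq : q = 0 := by
    have b : ∀ᶠ x in 𝓝[Ioo (0 : ℝ) 1] 0, |p * x ^ (2 * ν) + q| ≤ C * x ^ (ν + 1) := by
      filter_upwards [self_mem_nhdsWithin] with x hx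
      have hpos := Real.rpow_pos_of_pos hx.1 (-ν + 1 / 2)
      have e1 : x ^ (ν + 1 / 2) = x ^ (2 * ν) * x ^ (-ν + 1 / 2) := by
        rw [← Real.rpow_add hx.1]; ring_nf
      have e2 : x ^ (3 / 2 : ℝ) = x ^ (ν + 1) * x ^ (-ν + 1 / 2) := by
        rw [← Real.rpow_add hx.1]; ring_nf
      have := h x hx
      rw [h32 x hx.1, e1, e2, ← mul_assoc, ← add_mul, abs_mul, abs_of_pos hpos, ← mul_assoc] at this
      exact le_of_mul_le_mul_right this hpos
    have t1 : Tendsto (fun x : ℝ => |p * x ^ (2 * ν) + q|) (𝓝[Ioo 0 1] 0) (𝓝 |p * 0 + q|) :=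
      (((hlim _ (by linarith [hν.1])).const_mul p).add_const q).abs
    have t2 := (hlim (ν + 1) (by linarith [hν.1])).const_mul C
    have := le_of_tendsto_of_tendsto t1 t2 b
    simpa using this
  refine ⟨?_, hq⟩
  have b : ∀ᶠ x in 𝓝[Ioo (0 : ℝ) 1] 0, |p| ≤ C * x ^ (1 - ν) := by
    filter_upwards [self_mem_nhdsWithin] with x hx
    have hpos := Real.rpow_pos_of_pos hx.1 (ν + 1 / 2)
    have e2 : x ^ (3 / 2 : ℝ) = x ^ (1 - ν) * x ^ (ν + 1 / 2) := by
      rw [← Real.rpow_add hx.1]; ring_nf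
    have := h x hx
    rw [h32 x hx.1, hq, e2, zero_mul, add_zero, abs_mul, abs_of_pos hpos, ← mul_assoc] at this
    exact le_of_mul_le_mul_right this hpos
  have t2 := (hlim (1 - ν) (by linarith [hν.2])).const_mul C
  have := ge_of_tendsto t2 b
  simpa using this

/-! ### Passing from the interval to one of its halves -/

section

variable {σ : ℝ} (hσ : σ = 1 ∨ σ = -1)
include hσ

theorem sign_mul_self : σ * σ = 1 := by
  rcases hσ with rfl | rfl <;> norm_num

theorem sign_mul_cancel (x : ℝ) : σ * (σ * x) = x := by
  rw [← mul_assoc, sign_mul_self hσ, one_mul]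

/-- The sign `σ = ±1` treats both halves at once: `x ↦ σ x` carries `(0, 1)` to one of them and
preserves Lebesgue measure. -/
theorem ae_volHalf_of_ae_vol {P : ℝ → Prop} (h : ∀ᵐ x ∂vol, P x) : ∀ᵐ x ∂volHalf, P (σ * x) := by
  rw [ae_restrict_iff' measurableSet_Ioo] at h ⊢
  have h' : ∀ᵐ x : ℝ, σ * x ∈ Ioo (-1 : ℝ) 1 → P (σ * x) := by
    rcases hσ with rfl | rfl
    · simpa using h
    · simpa using (Measure.measurePreserving_neg (volume : Measure ℝ)).quasiMeasurePreserving.ae h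
  filter_upwards [h'] with x hx hm
  refine hx ?_
  rcases hσ with rfl | rfl
  · exact ⟨by linarith [hm.1], by linarith [hm.2]⟩
  · exact ⟨by linarith [hm.2], by linarith [hm.1]⟩

theorem integral_vol_eq_integral_volHalf {g : ℝ → ℝ} (hg : ∀ x, σ * x ∉ Ioo (0 : ℝ) 1 → g x = 0) :
    ∫ x, g x ∂vol = ∫ x, g (σ * x) ∂volHalf := by
  rw [setIntegral_eq_integral_of_forall_compl_eq_zero,
    setIntegral_eq_integral_of_forall_compl_eq_zero]
  · rcases hσ with rfl | rfl
    · simp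
    · simp [integral_neg_eq_self g volume]
  · intro x hx
    exact hg _ (by rwa [sign_mul_cancel hσ])
  · intro x hx
    refine hg x fun h => hx ?_
    rcases hσ with rfl | rfl
    · exact ⟨by linarith [h.1], by linarith [h.2]⟩
    · exact ⟨by linarith [h.2], by linarith [h.1]⟩

theorem isTest_comp_sign {φ : ℝ → ℝ} (hφ : IsTest (Ioo 0 1) φ) :
    IsTest punctured (fun x => φ (σ * x)) := by
  have hne : σ ≠ 0 := by rcases hσ with rfl | rfl <;> norm_num
  have hts : tsupport (fun x => φ (σ * x)) = (fun x => σ * x) ⁻¹' tsupport φ :=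
    tsupport_comp_eq_preimage φ (Homeomorph.mulLeft₀ σ hne)
  refine ⟨hφ.1.comp (contDiff_const.mul contDiff_id),
    hφ.2.1.comp_homeomorph (Homeomorph.mulLeft₀ σ hne), ?_⟩
  rw [hts]
  intro x hx
  have h := hφ.2.2 hx
  rcases hσ with rfl | rfl
  · exact Or.inr ⟨by linarith [h.1], by linarith [h.2]⟩
  · exact Or.inl ⟨by linarith [h.2], by linarith [h.1]⟩

omit hσ in
theorem deriv_comp_const_mul (φ : ℝ → ℝ) (σ : ℝ) :
    deriv (fun x => φ (σ * x)) = fun x => σ * deriv φ (σ * x) := by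
  funext x
  simpa using deriv_comp_mul_left σ φ x

omit hσ in
theorem punctured_subset : punctured ⊆ Ioo (-1 : ℝ) 1 := by
  rintro x (hx | hx)
  · exact ⟨hx.1, hx.2.trans one_pos⟩
  · exact ⟨by linarith [hx.1], hx.2⟩

theorem HasWeakDeriv.half {f g : L2} (h : HasWeakDeriv f g) {φ : ℝ → ℝ} (hφ : IsTest (Ioo 0 1) φ) :
    ∫ x, f (σ * x) * deriv φ x ∂volHalf = -∫ x, σ * g (σ * x) * φ x ∂volHalf := by
  have h1 := h _ ((isTest_comp_sign hσ hφ).mono punctured_subset)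
  rw [deriv_comp_const_mul,
    integral_vol_eq_integral_volHalf hσ fun x hx => by
      simp only [(isTest_deriv hφ).eq_zero hx, mul_zero],
    integral_vol_eq_integral_volHalf hσ fun x hx => by rw [hφ.eq_zero hx, mul_zero]] at h1
  simp only [sign_mul_cancel hσ] at h1
  have e1 : ∫ x, f (σ * x) * deriv φ x ∂volHalf
      = σ * ∫ x, f (σ * x) * (σ * deriv φ x) ∂volHalf := by
    rw [← integral_const_mul]
    refine integral_congr_ae (Eventually.of_forall fun x => ?_)
    linear_combination (-(f (σ * x) * deriv φ x)) * sign_mul_self hσ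
  rw [e1, h1, mul_neg, ← integral_const_mul]
  simp only [mul_assoc]

/-- The equation is invariant under reflection, since both the second derivative and `x²` only see
`σ² = 1`. -/
theorem SolvesWeakly.half {ν E : ℝ} {f : L2} (h : SolvesWeakly ν f (E • f)) {φ : ℝ → ℝ}
    (hφ : IsTest (Ioo 0 1) φ) :
    ∫ x, f (σ * x) * (-deriv (deriv φ) x + (ν ^ 2 - 1 / 4) / x ^ 2 * φ x - E * φ x) ∂volHalf
      = 0 := by
  have ht := isTest_comp_sign hσ hφ
  have h1 := h _ ht
  have i1 := integrable_solves ν f ht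
  have i2 := (integrable_mul f ht.1.continuous ht.2.1).const_mul E
  rw [integral_smul_mul, ← integral_const_mul, ← sub_eq_zero, ← integral_sub i1 i2] at h1
  have e : deriv (deriv fun x => φ (σ * x)) = fun x => deriv (deriv φ) (σ * x) := by
    have hs : ∀ g : ℝ → ℝ, deriv (fun x => σ * g x) = fun x => σ * deriv g x := fun g => by
      funext x; exact deriv_const_mul_field σ
    rw [deriv_comp_const_mul, hs, deriv_comp_const_mul]
    simp only [sign_mul_cancel hσ]
  rw [e, integral_vol_eq_integral_volHalf hσ fun x hx => by
      simp [(isTest_deriv (isTest_deriv hφ)).eq_zero hx, hφ.eq_zero hx]] at h1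
  rw [← h1]
  refine integral_congr_ae (Eventually.of_forall fun x => ?_)
  have : (σ * x) ^ 2 = x ^ 2 := by
    rw [mul_pow, pow_two σ, sign_mul_self hσ, one_mul]
  simp only [sign_mul_cancel hσ, this]
  ring

theorem measurePreserving_sign_mul : MeasurePreserving (fun x : ℝ => σ * x) volume volume := by
  rcases hσ with rfl | rfl
  · simpa using! MeasurePreserving.id volume
  · simpa using Measure.measurePreserving_neg (volume : Measure ℝ)

theorem memLp_half (f : L2) : MemLp (fun x => f (σ * x)) 2 volHalf := by
  -- Extension by zero makes the measure-preserving map on the whole line available.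
  have h1 : MemLp ((Ioo (-1 : ℝ) 1).indicator f) 2 volume :=
    (memLp_indicator_iff_restrict measurableSet_Ioo).2 (Lp.memLp f)
  have h2 := (h1.comp_measurePreserving (measurePreserving_sign_mul hσ)).restrict (Ioo 0 1)
  refine h2.ae_eq ?_
  filter_upwards [ae_restrict_mem measurableSet_Ioo] with x hx
  have : σ * x ∈ Ioo (-1 : ℝ) 1 := by
    rcases hσ with rfl | rfl
    · exact ⟨by linarith [hx.1], by linarith [hx.2]⟩
    · exact ⟨by linarith [hx.2], by linarith [hx.1]⟩
  simp [this]

theorem HasValueAt.half {f : L2} {x a : ℝ} (h : HasValueAt f (σ * x) a) :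
    ∃ v : ℝ → ℝ, (fun y => f (σ * y)) =ᵐ[volHalf] v ∧ Tendsto v (𝓝[Ioo 0 1] x) (𝓝 a) := by
  obtain ⟨u, hu, hc, rfl⟩ := h
  refine ⟨fun y => u (σ * y), ae_volHalf_of_ae_vol hσ hu, ?_⟩
  refine hc.tendsto.comp (tendsto_nhdsWithin_of_tendsto_nhds_of_eventually_within _ ?_ ?_)
  · exact ((continuous_const_mul σ).tendsto x).mono_left nhdsWithin_le_nhds
  · filter_upwards [self_mem_nhdsWithin] with y hy
    rcases hσ with rfl | rfl
    · exact ⟨by linarith [hy.1], by linarith [hy.2]⟩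
    · exact ⟨by linarith [hy.2], by linarith [hy.1]⟩

end

/-! ### Combinations of two generalized power series -/

/-- A linear combination of two generalized power series. -/
noncomputable def combo (s t : ℝ) (α β : ℕ → ℝ) (a b x : ℝ) : ℝ :=
  a * rpowSeries s α x + b * rpowSeries t β x

section

variable {s t : ℝ} {α β : ℕ → ℝ} (hα : EntireCoeff α) (hβ : EntireCoeff β) (a b : ℝ)
include hα hβ

theorem hasDerivAt_combo {x : ℝ} (hx : 0 < x) : HasDerivAt (combo s t α β a b)
    (combo (s - 1) (t - 1) (rpowDerivCoeff s α) (rpowDerivCoeff t β) a b x) x :=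
  ((hasDerivAt_rpowSeries s hα hx).const_mul a).add ((hasDerivAt_rpowSeries t hβ hx).const_mul b)

theorem continuousOn_combo : ContinuousOn (combo s t α β a b) (Ioi 0) := fun _ hx =>
  (hasDerivAt_combo hα hβ a b hx).continuousAt.continuousWithinAt

theorem memLp_combo (hs : -(1 / 2) < s) (ht : -(1 / 2) < t) :
    MemLp (combo s t α β a b) 2 volHalf :=
  ((memLp_rpowSeries hs hα).const_mul a).add ((memLp_rpowSeries ht hβ).const_mul b)

theorem tendsto_combo (hs : 0 < s) (ht : 0 < t) :
    Tendsto (combo s t α β a b) (𝓝[>] 0) (𝓝 0) := by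
  simpa using! ((tendsto_rpowSeries_zero hs hα).const_mul a).add
    ((tendsto_rpowSeries_zero ht hβ).const_mul b)

omit hα hβ in
theorem combo_zero (hs : 0 < s) (ht : 0 < t) : combo s t α β a b 0 = 0 := by
  simp [combo, rpowSeries, Real.zero_rpow hs.ne', Real.zero_rpow ht.ne']

theorem exists_abs_combo_le (hs : 3 / 2 ≤ s) (ht : 3 / 2 ≤ t) :
    ∃ C, ∀ x ∈ Ioo (0 : ℝ) 1, |combo s t α β a b x| ≤ C * (x * √x) := by
  have h32 : ∀ x : ℝ, 0 < x → x * √x = x ^ (3 / 2 : ℝ) := by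
    intro x hx
    rw [Real.sqrt_eq_rpow, ← Real.rpow_one_add' hx.le (by norm_num)]
    norm_num
  obtain ⟨C, hC, h1⟩ := exists_abs_rpowSeries_le s hα
  obtain ⟨D, hD, h2⟩ := exists_abs_rpowSeries_le t hβ
  refine ⟨|a| * C + |b| * D, fun x hx => ?_⟩
  have hx' : x ∈ Ioc (0 : ℝ) 1 := ⟨hx.1, hx.2.le⟩
  have e1 := Real.rpow_le_rpow_of_exponent_ge hx.1 hx.2.le hs
  have e2 := Real.rpow_le_rpow_of_exponent_ge hx.1 hx.2.le ht
  rw [h32 x hx.1]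
  calc |combo s t α β a b x| ≤ |a| * |rpowSeries s α x| + |b| * |rpowSeries t β x| := by
        rw [← abs_mul, ← abs_mul]; exact abs_add_le _ _
    _ ≤ |a| * (C * x ^ (3 / 2 : ℝ)) + |b| * (D * x ^ (3 / 2 : ℝ)) := by
        have k1 := (h1 x hx').trans (mul_le_mul_of_nonneg_left e1 hC)
        have k2 := (h2 x hx').trans (mul_le_mul_of_nonneg_left e2 hD)
        gcongr
    _ = _ := by ring

end

/-- The combination of the two Bessel solutions. -/
noncomputable abbrev besselCombo (ν E : ℝ) : ℝ → ℝ → ℝ → ℝ :=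
  combo (ν + 1 / 2) (-ν + 1 / 2) (besselCoeff ν E) (besselCoeff (-ν) E)

/-- The combination of the two Bessel solutions, without the leading terms at the origin. -/
noncomputable abbrev besselRemainder (ν E : ℝ) : ℝ → ℝ → ℝ → ℝ :=
  combo (ν + 1 / 2 + 2) (-ν + 1 / 2 + 2) (fun k => besselCoeff ν E (k + 1))
    (fun k => besselCoeff (-ν) E (k + 1))

section

variable {ν : ℝ} (hν : ν ∈ Ioo (0 : ℝ) 1) {E : ℝ}
include hν

theorem besselCombo_eq_add_remainder (a b : ℝ) {x : ℝ} (hx : 0 < x) :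
    besselCombo ν E a b x = a * besselCoeff ν E 0 * x ^ (ν + 1 / 2)
      + b * besselCoeff (-ν) E 0 * x ^ (-ν + 1 / 2) + besselRemainder ν E a b x := by
  simp only [besselCombo, besselRemainder, combo]
  rw [rpowSeries_eq_add_tail _ (entireCoeff_besselCoeff (by linarith [hν.1]) E) hx,
    rpowSeries_eq_add_tail _ (entireCoeff_besselCoeff (by linarith [hν.2]) E) hx]
  ring

/-- If a combination of the Bessel solutions is the sum of an `H²` function vanishing to second
order at the origin and of a singular part, the latter consists of the leading terms. -/
theorem singular_coeff_eq {h h₁ h₂ v v₁ : ℝ → ℝ} {a b c₁ c₂ : ℝ} (i₁ : MemLp h₁ 2 volHalf)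
    (i₂ : MemLp h₂ 2 volHalf)
    (w₁ : ∀ φ, IsTest (Ioo 0 1) φ → ∫ x, h x * deriv φ x ∂volHalf = -∫ x, h₁ x * φ x ∂volHalf)
    (w₂ : ∀ φ, IsTest (Ioo 0 1) φ → ∫ x, h₁ x * deriv φ x ∂volHalf = -∫ x, h₂ x * φ x ∂volHalf)
    (hv : h =ᵐ[volHalf] v) (hv₁ : h₁ =ᵐ[volHalf] v₁)
    (l : Tendsto v (𝓝[Ioo 0 1] 0) (𝓝 0)) (l₁ : Tendsto v₁ (𝓝[Ioo 0 1] 0) (𝓝 0))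
    (hh : ∀ᵐ x ∂volHalf,
      h x + (c₁ * x ^ (ν + 1 / 2) + c₂ * x ^ (-ν + 1 / 2)) = besselCombo ν E a b x) :
    c₁ = a * besselCoeff ν E 0 ∧ c₂ = b * besselCoeff (-ν) E 0 := by
  have hα := (entireCoeff_besselCoeff (by linarith [hν.1] : -1 < ν) E).tail
  have hβ := (entireCoeff_besselCoeff (by linarith [hν.2] : -1 < -ν) E).tail
  -- `p` and `q` are the discrepancies to be shown zero; `F` is the smooth representative of `h`
  -- built from them and the remainder.
  set p := a * besselCoeff ν E 0 - c₁ with hp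
  set q := b * besselCoeff (-ν) E 0 - c₂ with hq
  set s := ν + 1 / 2 with hs
  set t := -ν + 1 / 2 with ht
  have hpow : ∀ p r : ℝ, ∀ x, 0 < x →
      HasDerivAt (fun x : ℝ => p * x ^ r) (p * r * x ^ (r - 1)) x := fun p r x hx =>
    ((Real.hasDerivAt_rpow_const (p := r) (Or.inl hx.ne')).const_mul p).congr_deriv (by ring)
  have hpc : ∀ p r : ℝ, ContinuousOn (fun x : ℝ => p * x ^ r) (Ioi 0) := fun p r x hx =>
    (hpow p r x hx).continuousAt.continuousWithinAt
  set F : ℝ → ℝ := fun x => p * x ^ s + q * x ^ t + besselRemainder ν E a b x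
  set F₁ : ℝ → ℝ := fun x => p * s * x ^ (s - 1) + q * t * x ^ (t - 1)
    + combo (s + 2 - 1) (t + 2 - 1) (rpowDerivCoeff (s + 2) fun k => besselCoeff ν E (k + 1))
      (rpowDerivCoeff (t + 2) fun k => besselCoeff (-ν) E (k + 1)) a b x
  set F₂ : ℝ → ℝ := fun x => p * s * (s - 1) * x ^ (s - 1 - 1) + q * t * (t - 1) * x ^ (t - 1 - 1)
    + combo (s + 2 - 1 - 1) (t + 2 - 1 - 1)
      (rpowDerivCoeff (s + 2 - 1) (rpowDerivCoeff (s + 2) fun k => besselCoeff ν E (k + 1)))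
      (rpowDerivCoeff (t + 2 - 1) (rpowDerivCoeff (t + 2) fun k => besselCoeff (-ν) E (k + 1))) a b x
  have d1 : ∀ x ∈ Ioo (0 : ℝ) 1, HasDerivAt F (F₁ x) x := fun x hx =>
    ((hpow p s x hx.1).add (hpow q t x hx.1)).add (hasDerivAt_combo hα hβ a b hx.1)
  have d2 : ∀ x ∈ Ioo (0 : ℝ) 1, HasDerivAt F₁ (F₂ x) x := fun x hx =>
    ((hpow _ _ x hx.1).add (hpow _ _ x hx.1)).add
      (hasDerivAt_combo (hα.rpowDerivCoeff _) (hβ.rpowDerivCoeff _) a b hx.1)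
  have c0 : ContinuousOn F (Ioo 0 1) := fun x hx => (d1 x hx).continuousAt.continuousWithinAt
  have c1 : ContinuousOn F₁ (Ioo 0 1) := fun x hx => (d2 x hx).continuousAt.continuousWithinAt
  have c2 : ContinuousOn F₂ (Ioo 0 1) :=
    (((hpc _ _).add (hpc _ _)).add (continuousOn_combo ((hα.rpowDerivCoeff _).rpowDerivCoeff _)
      ((hβ.rpowDerivCoeff _).rpowDerivCoeff _) a b)).mono Ioo_subset_Ioi_self
  have e0 : h =ᵐ[volHalf] F := by
    filter_upwards [hh, ae_restrict_mem measurableSet_Ioo] with x hx hm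
    rw [besselCombo_eq_add_remainder hν a b hm.1] at hx
    simp only [F, p, q]
    linarith
  have e1 : h₁ =ᵐ[volHalf] F₁ :=
    ae_eq_of_weak_deriv (i₁.integrable (by norm_num)) w₁ d1 c1 e0
  have e2 : h₂ =ᵐ[volHalf] F₂ :=
    ae_eq_of_weak_deriv (i₂.integrable (by norm_num)) w₂ d2 c2 e1
  obtain ⟨C, hC⟩ := exists_abs_le_of_hasDerivAt d1 d2 c2 (i₂.ae_eq e2)
    (tendsto_of_ae_eq_of_continuousOn c0 (e0.symm.trans hv) l)
    (tendsto_of_ae_eq_of_continuousOn c1 (e1.symm.trans hv₁) l₁)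
  obtain ⟨D, hD⟩ := exists_abs_combo_le (s := s + 2) (t := t + 2) hα hβ a b
    (by linarith [hν.1]) (by linarith [hν.2])
  -- `F` is `O(x^{3/2})` as an `H²` function vanishing to second order, the Bessel remainder because
  -- its exponents exceed `3/2`; so the discrepancy is too.
  obtain ⟨z1, z2⟩ := eq_zero_of_abs_le (p := p) (q := q) (C := C + D) hν fun x hx => by
    have h1 := hC x hx
    have h2 := hD x hx
    have h3 : p * x ^ s + q * x ^ t = F x - besselRemainder ν E a b x := by
      simp only [F]; ring
    rw [← hs, ← ht, h3, add_mul]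
    exact (abs_sub _ _).trans (add_le_add h1 h2)
  exact ⟨by linarith, by linarith⟩

/-- All information carried by one half: the two Bessel coefficients, their link with the singular
coefficients, and the Dirichlet condition. Only the transmission conditions couple the halves. -/
theorem exists_coeff_half (hE : 0 < E) {σ : ℝ} (hσ : σ = 1 ∨ σ = -1) {f fr fs : L2}
    (hsol : SolvesWeakly ν f (E • f)) (hb : HasValueAt f σ 0) (hfr : fr ∈ H20) (hf : f = fr + fs)
    {S : ℝ → ℝ} (hS : fs =ᵐ[vol] S) {c₁ c₂ : ℝ}
    (hSc : ∀ x, 0 < x → S (σ * x) = c₁ * x ^ (ν + 1 / 2) + c₂ * x ^ (-ν + 1 / 2)) :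
    ∃ a b : ℝ, (∀ᵐ x ∂volHalf, f (σ * x) = besselCombo ν E a b x) ∧
      c₁ = a * besselCoeff ν E 0 ∧ c₂ = b * besselCoeff (-ν) E 0 ∧ besselCombo ν E a b 1 = 0 := by
  have hα := entireCoeff_besselCoeff (by linarith [hν.1] : -1 < ν) E
  have hβ := entireCoeff_besselCoeff (by linarith [hν.2] : -1 < -ν) E
  obtain ⟨a, b, hab⟩ := exists_eq_besselSol_of_weak hν hE
    ((memLp_half hσ f).integrable (by norm_num)) fun φ hφ => hsol.half hσ hφ
  have hab' : ∀ᵐ x ∂volHalf, f (σ * x) = besselCombo ν E a b x := hab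
  obtain ⟨f', f'', w₁, w₂, v0, v1⟩ := hfr
  obtain ⟨v, hv, lv⟩ := HasValueAt.half hσ (f := fr) (x := 0) (a := 0) (by rwa [mul_zero])
  obtain ⟨v', hv', lv'⟩ := HasValueAt.half hσ (f := f') (x := 0) (a := 0) (by rwa [mul_zero])
  obtain ⟨u, hu, lu⟩ := HasValueAt.half hσ (f := f) (x := 1) (a := 0) (by rwa [mul_one])
  have hsum : ∀ᵐ x ∂volHalf, f (σ * x) = fr (σ * x) + fs (σ * x) := by
    subst hf
    exact ae_volHalf_of_ae_vol hσ (P := fun y => (fr + fs : L2) y = fr y + fs y)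
      (Lp.coeFn_add fr fs)
  -- By the chain rule each derivative contributes a factor `σ`; it is kept in `h₁` and squares to
  -- `1` in `h₂`.
  obtain ⟨h1, h2⟩ := singular_coeff_eq hν (E := E) (h := fun x => fr (σ * x))
    (h₁ := fun x => σ * f' (σ * x)) (h₂ := fun x => f'' (σ * x)) (v := v)
    (v₁ := fun x => σ * v' x) (a := a) (b := b) (c₁ := c₁) (c₂ := c₂)
    ((memLp_half hσ f').const_mul σ) (memLp_half hσ f'') (fun φ hφ => w₁.half hσ hφ)
    (fun φ hφ => by
      have := w₂.half hσ hφ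
      simp only [mul_assoc] at this ⊢
      rw [integral_const_mul] at this
      rw [integral_const_mul, this, mul_neg, sign_mul_cancel hσ]) hv
    (by filter_upwards [hv'] with x hx using by rw [hx]) lv (by simpa using lv'.const_mul σ)
    (by
      filter_upwards [hab', hsum, ae_volHalf_of_ae_vol hσ hS, ae_restrict_mem measurableSet_Ioo]
        with x k1 k2 k3 k4
      rw [← k1, k2, k3, hSc x k4.1])
  refine ⟨a, b, hab', h1, h2, ?_⟩
  have hc := continuousOn_combo (s := ν + 1 / 2) (t := -ν + 1 / 2) hα hβ a b
  have l1 := tendsto_of_ae_eq_of_continuousOn (hc.mono Ioo_subset_Ioi_self)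
    ((EventuallyEq.symm hab').trans hu) lu
  have l2 : Tendsto (besselCombo ν E a b) (𝓝[Ioo 0 1] 1) (𝓝 (besselCombo ν E a b 1)) :=
    (hc.continuousAt (Ioi_mem_nhds one_pos)).tendsto.mono_left nhdsWithin_le_nhds
  have hnb : (𝓝[Ioo (0 : ℝ) 1] 1).NeBot := by
    rw [nhdsWithin_Ioo_eq_nhdsLT one_pos]; infer_instance
  exact tendsto_nhds_unique l2 l1

end

/-! ### Functions given separately on the two halves -/

/-- The function equal to `p (-x)` for `x < 0` and to `q x` for `x ≥ 0`. -/
noncomputable def glue (p q : ℝ → ℝ) (x : ℝ) : ℝ := if x < 0 then p (-x) else q x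

theorem glue_of_neg (p q : ℝ → ℝ) {x : ℝ} (hx : x < 0) : glue p q x = p (-x) := if_pos hx

theorem glue_of_pos (p q : ℝ → ℝ) {x : ℝ} (hx : 0 < x) : glue p q x = q x := if_neg hx.not_gt

theorem ae_vol_of_ae_volHalf {P : ℝ → Prop} (hm : ∀ᵐ x ∂volHalf, P (-x))
    (hp : ∀ᵐ x ∂volHalf, P x) : ∀ᵐ x ∂vol, P x := by
  rw [ae_restrict_iff' measurableSet_Ioo] at hm hp ⊢
  have hm' : ∀ᵐ x : ℝ, -x ∈ Ioo (0 : ℝ) 1 → P (- -x) :=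
    (Measure.measurePreserving_neg (volume : Measure ℝ)).quasiMeasurePreserving.ae hm
  have hne : ∀ᵐ x : ℝ, x ≠ 0 := by simp [ae_iff]
  filter_upwards [hm', hp, hne] with x h1 h2 h3 hx
  rcases lt_or_gt_of_ne h3 with h | h
  · simpa using h1 ⟨by linarith, by linarith [hx.1]⟩
  · exact h2 ⟨h, hx.2⟩

theorem ae_eq_glue {f : ℝ → ℝ} {p q : ℝ → ℝ} (hm : ∀ᵐ x ∂volHalf, f (-x) = p x)
    (hp : ∀ᵐ x ∂volHalf, f x = q x) : f =ᵐ[vol] glue p q := by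
  refine ae_vol_of_ae_volHalf ?_ ?_
  · filter_upwards [hm, ae_restrict_mem measurableSet_Ioo] with x h hx
    rw [h, glue_of_neg _ _ (neg_lt_zero.2 hx.1), neg_neg]
  · filter_upwards [hp, ae_restrict_mem measurableSet_Ioo] with x h hx
    rw [h, glue_of_pos _ _ hx.1]

theorem memLp_glue {p q : ℝ → ℝ} (hp : MemLp p 2 volHalf) (hq : MemLp q 2 volHalf) :
    MemLp (glue p q) 2 vol := by
  have h1 := (memLp_indicator_iff_restrict measurableSet_Ioo).2 hp
  have h2 := (memLp_indicator_iff_restrict measurableSet_Ioo).2 hq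
  have h3 := (h1.comp_measurePreserving (Measure.measurePreserving_neg (volume : Measure ℝ))).add h2
  refine (h3.restrict (Ioo (-1) 1)).ae_eq (ae_eq_glue ?_ ?_)
  · filter_upwards [ae_restrict_mem measurableSet_Ioo] with x hx
    have : -x ∉ Ioo (0 : ℝ) 1 := fun h => by linarith [h.1, hx.1]
    simp [hx, this]
  · filter_upwards [ae_restrict_mem measurableSet_Ioo] with x hx
    have : -x ∉ Ioo (0 : ℝ) 1 := fun h => by linarith [h.1, hx.1]
    simp [hx, this]

section

variable {p q p' q' : ℝ → ℝ} (dp : ∀ x, 0 < x → HasDerivAt p (p' x) x)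
  (dq : ∀ x, 0 < x → HasDerivAt q (q' x) x)
include dp dq

theorem hasDerivAt_glue {x : ℝ} (hx : x ≠ 0) :
    HasDerivAt (glue p q) (glue (fun y => -p' y) q' x) x := by
  rcases lt_or_gt_of_ne hx with h | h
  · rw [glue_of_neg _ _ h]
    have h1 := (dp (-x) (neg_pos.2 h)).comp x (hasDerivAt_neg x)
    rw [mul_neg_one] at h1
    refine h1.congr_of_eventuallyEq ?_
    filter_upwards [Iio_mem_nhds h] with y hy using glue_of_neg _ _ hy
  · rw [glue_of_pos _ _ h]
    refine (dq x h).congr_of_eventuallyEq ?_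
    filter_upwards [Ioi_mem_nhds h] with y hy using glue_of_pos _ _ hy

theorem continuous_glue (lp : Tendsto p (𝓝[>] 0) (𝓝 0)) (lq : Tendsto q (𝓝[>] 0) (𝓝 0))
    (h0 : q 0 = 0) : Continuous (glue p q) := by
  refine continuous_iff_continuousAt.2 fun x => ?_
  rcases eq_or_ne x 0 with rfl | hx
  · have e : glue p q 0 = 0 := by simp [glue, h0]
    rw [continuousAt_iff_continuous_left'_right', ContinuousWithinAt, ContinuousWithinAt, e]
    refine ⟨?_, ?_⟩
    · refine (lp.comp (f := fun y => -y) (x := 𝓝[<] (0 : ℝ)) ?_).congr' ?_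
      · simpa using tendsto_neg_nhdsLT (a := (0 : ℝ))
      · filter_upwards [self_mem_nhdsWithin] with y hy using (glue_of_neg _ _ hy).symm
    · refine lq.congr' ?_
      filter_upwards [self_mem_nhdsWithin] with y hy using (glue_of_pos _ _ hy).symm
  · exact (hasDerivAt_glue dp dq hx).continuousAt

end

/-- Continuity of `F` across the origin excludes a point mass there, so the fundamental theorem of
calculus holds despite the exceptional point. -/
theorem hasWeakDeriv_of_hasDerivAt {f g : L2} {F G : ℝ → ℝ} (hF : Continuous F)
    (hd : ∀ x ≠ 0, HasDerivAt F (G x) x) (hf : f =ᵐ[vol] F) (hg : g =ᵐ[vol] G) :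
    HasWeakDeriv f g := by
  intro φ hφ
  have dφ : ∀ x, HasDerivAt φ (deriv φ x) x := fun x =>
    (hφ.1.differentiable (by simp) x).hasDerivAt
  have i1 := (integrable_mul g hφ.1.continuous hφ.2.1)
  have i2 := (integrable_mul f (isTest_deriv hφ).1.continuous (isTest_deriv hφ).2.1)
  have e : (fun x => g x * φ x + f x * deriv φ x)
      =ᵐ[vol] fun x => G x * φ x + F x * deriv φ x := by
    filter_upwards [hf, hg] with x h1 h2
    rw [h1, h2]
  have hle : (-1 : ℝ) ≤ 1 := by norm_num
  have h := integral_eq_of_hasDerivAt_off_countable (fun x => F x * φ x)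
    (fun x => G x * φ x + F x * deriv φ x) (a := -1) (b := 1) (countable_singleton (0 : ℝ))
    (hF.mul hφ.1.continuous).continuousOn (fun x hx => (hd x hx.2).mul (dφ x))
    ((intervalIntegrable_iff_integrableOn_Ioo_of_le hle).2 ((i1.add i2).congr e))
  rw [intervalIntegral.integral_of_le hle, integral_Ioc_eq_integral_Ioo, ← integral_congr_ae e,
    integral_add i1 i2, hφ.eq_zero (x := 1) (by simp), hφ.eq_zero (x := -1) (by simp)] at h
  linarith

/-- The functions and their first derivatives tend to `0` at the origin from both sides, so the
glued function and its derivative match there. The left derivative changes sign by reflection. -/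
theorem mem_H20_of_ae_eq_glue {f : L2} {p q p' q' p'' q'' : ℝ → ℝ}
    (dp : ∀ x, 0 < x → HasDerivAt p (p' x) x) (dq : ∀ x, 0 < x → HasDerivAt q (q' x) x)
    (dp' : ∀ x, 0 < x → HasDerivAt p' (p'' x) x) (dq' : ∀ x, 0 < x → HasDerivAt q' (q'' x) x)
    (lp : Tendsto p (𝓝[>] 0) (𝓝 0)) (lq : Tendsto q (𝓝[>] 0) (𝓝 0)) (h0 : q 0 = 0)
    (lp' : Tendsto p' (𝓝[>] 0) (𝓝 0)) (lq' : Tendsto q' (𝓝[>] 0) (𝓝 0)) (h0' : q' 0 = 0)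
    (mp' : MemLp p' 2 volHalf) (mq' : MemLp q' 2 volHalf)
    (mp'' : MemLp p'' 2 volHalf) (mq'' : MemLp q'' 2 volHalf) (hf : f =ᵐ[vol] glue p q) :
    f ∈ H20 := by
  have dn : ∀ x, 0 < x → HasDerivAt (fun y => -p' y) (-p'' x) x := fun x hx => (dp' x hx).neg
  have ln : Tendsto (fun y => -p' y) (𝓝[>] 0) (𝓝 0) := by simpa using lp'.neg
  have c0 := continuous_glue dp dq lp lq h0
  have c1 := continuous_glue dn dq' ln lq' h0'
  have m1 : MemLp (glue (fun y => -p' y) q') 2 vol := memLp_glue mp'.neg mq'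
  have m2 : MemLp (glue (fun y => - -p'' y) q'') 2 vol := memLp_glue mp''.neg.neg mq''
  refine ⟨m1.toLp _, m2.toLp _, ?_, ?_, ⟨_, hf, c0.continuousWithinAt, by simp [glue, h0]⟩,
    ⟨_, m1.coeFn_toLp, c1.continuousWithinAt, by simp [glue, h0']⟩⟩
  · exact hasWeakDeriv_of_hasDerivAt c0 (fun x hx => hasDerivAt_glue dp dq hx) hf m1.coeFn_toLp
  · exact hasWeakDeriv_of_hasDerivAt c1 (fun x hx => hasDerivAt_glue dn dq' hx) m1.coeFn_toLp
      m2.coeFn_toLp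

theorem isOpen_punctured : IsOpen punctured := isOpen_Ioo.union isOpen_Ioo

/-- Two integrations by parts. Nothing is required at the origin because the test functions are
supported away from it. -/
theorem solvesWeakly_of_hasDerivAt {ν E : ℝ} {f : L2} {F F' : ℝ → ℝ}
    (hd : ∀ x ≠ 0, HasDerivAt F (F' x) x)
    (hd' : ∀ x ≠ 0, HasDerivAt F' (((ν ^ 2 - 1 / 4) / x ^ 2 - E) * F x) x)
    (hf : f =ᵐ[vol] F) : SolvesWeakly ν f (E • f) := by
  intro φ hφ
  have hne : ∀ x ∈ punctured, x ≠ 0 := by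
    rintro x (hx | hx)
    · exact hx.2.ne
    · exact hx.1.ne'
  have c0 : ContinuousOn F punctured := fun x hx =>
    (hd x (hne x hx)).continuousAt.continuousWithinAt
  have c1 : ContinuousOn F' punctured := fun x hx =>
    (hd' x (hne x hx)).continuousAt.continuousWithinAt
  have c2 : ContinuousOn (fun x => ((ν ^ 2 - 1 / 4) / x ^ 2 - E) * F x) punctured :=
    ((continuousOn_const.div (continuousOn_pow 2) fun x hx => pow_ne_zero 2 (hne x hx)).sub
      continuousOn_const).mul c0
  have hφ' := isTest_deriv hφ
  have hφ'' := isTest_deriv hφ'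
  have e1 := hφ'.integral_mul_deriv isOpen_punctured (fun x hx => hd x (hne x hx)) c1
  have e2 := hφ.integral_mul_deriv isOpen_punctured (fun x hx => hd' x (hne x hx)) c2
  have i1 := hφ''.integrable_mul isOpen_punctured c0
  have i2 := hφ.integrable_mul isOpen_punctured c2
  have i3 := (hφ.integrable_mul isOpen_punctured c0).const_mul E
  have e3 : ∫ x, f x * (-deriv (deriv φ) x + (ν ^ 2 - 1 / 4) / x ^ 2 * φ x) ∂vol
      = ∫ x, F x * (-deriv (deriv φ) x + (ν ^ 2 - 1 / 4) / x ^ 2 * φ x) ∂vol :=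
    integral_congr_ae (by filter_upwards [hf] with x hx; rw [hx])
  have e4 : ∫ x, f x * φ x ∂vol = ∫ x, F x * φ x ∂vol :=
    integral_congr_ae (by filter_upwards [hf] with x hx; rw [hx])
  rw [integral_smul_mul, e3, e4, setIntegral_mul_eq hφ punctured_subset,
    setIntegral_eq_integral_of_forall_compl_eq_zero fun x hx => by
      have hx' := fun h => hx (punctured_subset h)
      rw [hφ''.eq_zero hx', hφ.eq_zero hx']; simp, ← integral_const_mul]
  have e5 := integral_add (i2.sub i1) i3
  have e6 := integral_sub i2 i1
  have e7 : ∫ x, F x * (-deriv (deriv φ) x + (ν ^ 2 - 1 / 4) / x ^ 2 * φ x)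
      = ∫ x, (((ν ^ 2 - 1 / 4) / x ^ 2 - E) * F x * φ x - F x * deriv (deriv φ) x)
        + E * (F x * φ x) := by
    refine integral_congr_ae (Eventually.of_forall fun x => ?_)
    ring
  refine e7.trans (e5.trans ?_)
  refine (congrArg (· + _) e6).trans ?_
  rw [e1, e2]
  ring

/-! ### The eigenspace -/

theorem mem_eigenspace_iff {ν E : ℝ} {f : L2} :
    f ∈ eigenspace (op ν) E ↔ f ∈ domain ν ∧ SolvesWeakly ν f (E • f) := by
  have h : (op ν).graph = opGraph ν :=
    Submodule.toLinearPMap_graph_eq _ (opGraph_functional ν)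
  have h1 : f ∈ eigenspace (op ν) E ↔ (f, E • f) ∈ (op ν).graph := by
    rw [LinearPMap.mem_graph_iff]
    constructor
    · rintro ⟨hf, hE⟩
      exact ⟨⟨f, hf⟩, rfl, hE⟩
    · rintro ⟨⟨y, hy⟩, rfl, hE⟩
      exact ⟨hy, hE⟩
  rw [h1, h]
  rfl

section

variable {ν : ℝ} (hν : ν ∈ Ioo (0 : ℝ) 1) {E : ℝ}
include hν

theorem memLp_besselCombo (a b : ℝ) : MemLp (besselCombo ν E a b) 2 volHalf :=
  memLp_combo (entireCoeff_besselCoeff (by linarith [hν.1]) E)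
    (entireCoeff_besselCoeff (by linarith [hν.2]) E) a b (by linarith [hν.1]) (by linarith [hν.2])

/-- Sufficiency of the coefficient conditions: the leading terms serve as singular part, and the
rest has to be placed in `H20`. -/
theorem mem_eigenspace_of_ae_eq_glue {f : L2} {am bm ap bp : ℝ}
    (hf : f =ᵐ[vol] glue (besselCombo ν E am bm) (besselCombo ν E ap bp))
    (t₁ : besselCoeff ν E 0 * (am + ap) + besselCoeff (-ν) E 0 * (bm + bp) = 0)
    (t₂ : (ν + 1 / 2) * besselCoeff ν E 0 * (am - ap)
      + (-ν + 1 / 2) * besselCoeff (-ν) E 0 * (bm - bp) = 0)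
    (hm : besselCombo ν E am bm 1 = 0) (hp : besselCombo ν E ap bp 1 = 0) :
    f ∈ eigenspace (op ν) E := by
  have hα := entireCoeff_besselCoeff (by linarith [hν.1] : -1 < ν) E
  have hβ := entireCoeff_besselCoeff (by linarith [hν.2] : -1 < -ν) E
  have dc : ∀ a b x, 0 < x → HasDerivAt (besselCombo ν E a b)
      (a * besselSolDeriv ν E x + b * besselSolDeriv (-ν) E x) x := fun a b x hx =>
    hasDerivAt_combo hα hβ a b hx
  have dc' : ∀ a b x, 0 < x →
      HasDerivAt (fun x => a * besselSolDeriv ν E x + b * besselSolDeriv (-ν) E x)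
        (((ν ^ 2 - 1 / 4) / x ^ 2 - E) * besselCombo ν E a b x) x := by
    intro a b x hx
    refine (((hasDerivAt_besselSolDeriv (by linarith [hν.1]) E hx).const_mul a).add
      ((hasDerivAt_besselSolDeriv (by linarith [hν.2]) E hx).const_mul b)).congr_deriv ?_
    simp only [besselCombo, combo, besselSol]
    ring
  have dg : ∀ x ≠ 0, HasDerivAt (glue (besselCombo ν E am bm) (besselCombo ν E ap bp)) _ x :=
    fun x hx => hasDerivAt_glue (dc am bm) (dc ap bp) hx
  rw [mem_eigenspace_iff]
  refine ⟨⟨⟨_, hf, (dg (-1) (by norm_num)).continuousAt.continuousWithinAt, ?_⟩,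
    ⟨_, hf, (dg 1 (by norm_num)).continuousAt.continuousWithinAt, ?_⟩, ?_⟩, ?_⟩
  · rw [glue_of_neg _ _ (by norm_num), neg_neg, hm]
  · rw [glue_of_pos _ _ one_pos, hp]
  · set c₁m := am * besselCoeff ν E 0 with h1m
    set c₂m := bm * besselCoeff (-ν) E 0 with h2m
    set c₁p := ap * besselCoeff ν E 0 with h1p
    set c₂p := bp * besselCoeff (-ν) E 0 with h2p
    have ms : ∀ c d : ℝ, MemLp (fun x : ℝ => c * x ^ (ν + 1 / 2) + d * x ^ (-ν + 1 / 2)) 2 volHalf :=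
      fun c d => ((memLp_rpow (by linarith [hν.1])).const_mul c).add
        ((memLp_rpow (by linarith [hν.2])).const_mul d)
    have hsm : ∀ x, 0 < x → singularFun ν c₁m c₂m c₁p c₂p (-x)
        = c₁m * x ^ (ν + 1 / 2) + c₂m * x ^ (-ν + 1 / 2) := fun x hx => by
      rw [singularFun, if_pos (neg_lt_zero.2 hx), abs_neg, abs_of_pos hx]
    have hsp : ∀ x, 0 < x → singularFun ν c₁m c₂m c₁p c₂p x
        = c₁p * x ^ (ν + 1 / 2) + c₂p * x ^ (-ν + 1 / 2) := fun x hx => by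
      rw [singularFun, if_neg hx.not_gt, abs_of_pos hx]
    have hS : singularFun ν c₁m c₂m c₁p c₂p =ᵐ[vol]
        glue (fun x => c₁m * x ^ (ν + 1 / 2) + c₂m * x ^ (-ν + 1 / 2))
          (fun x => c₁p * x ^ (ν + 1 / 2) + c₂p * x ^ (-ν + 1 / 2)) := by
      refine ae_eq_glue ?_ ?_ <;> filter_upwards [ae_restrict_mem measurableSet_Ioo] with x hx
      · exact hsm x hx.1
      · exact hsp x hx.1
    have mS : MemLp (singularFun ν c₁m c₂m c₁p c₂p) 2 vol :=
      (memLp_glue (ms c₁m c₂m) (ms c₁p c₂p)).ae_eq hS.symm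
    -- The remainder has exponents `±ν + 5/2`. Its second derivative has exponents `±ν + 1/2 >
    -- -1/2`, hence is square-integrable, and lower derivatives vanish at `0`.
    refine ⟨f - mS.toLp _, ?_, mS.toLp _, c₁m, c₂m, c₁p, c₂p, by abel, mS.coeFn_toLp, ?_, ?_⟩
    · have ha := hα.tail
      have hb := hβ.tail
      have hp := hν.1
      have hl := hν.2
      refine mem_H20_of_ae_eq_glue (p := besselRemainder ν E am bm)
        (q := besselRemainder ν E ap bp)
        (fun x hx => hasDerivAt_combo ha hb am bm hx)
        (fun x hx => hasDerivAt_combo ha hb ap bp hx)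
        (fun x hx => hasDerivAt_combo (ha.rpowDerivCoeff _) (hb.rpowDerivCoeff _) am bm hx)
        (fun x hx => hasDerivAt_combo (ha.rpowDerivCoeff _) (hb.rpowDerivCoeff _) ap bp hx)
        (tendsto_combo ha hb _ _ (by linarith) (by linarith))
        (tendsto_combo ha hb _ _ (by linarith) (by linarith))
        (combo_zero _ _ (by linarith) (by linarith))
        (tendsto_combo (ha.rpowDerivCoeff _) (hb.rpowDerivCoeff _) _ _ (by linarith) (by linarith))
        (tendsto_combo (ha.rpowDerivCoeff _) (hb.rpowDerivCoeff _) _ _ (by linarith) (by linarith))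
        (combo_zero _ _ (by linarith) (by linarith))
        (memLp_combo (ha.rpowDerivCoeff _) (hb.rpowDerivCoeff _) _ _ (by linarith) (by linarith))
        (memLp_combo (ha.rpowDerivCoeff _) (hb.rpowDerivCoeff _) _ _ (by linarith) (by linarith))
        (memLp_combo ((ha.rpowDerivCoeff _).rpowDerivCoeff _)
          ((hb.rpowDerivCoeff _).rpowDerivCoeff _) _ _ (by linarith) (by linarith))
        (memLp_combo ((ha.rpowDerivCoeff _).rpowDerivCoeff _)
          ((hb.rpowDerivCoeff _).rpowDerivCoeff _) _ _ (by linarith) (by linarith)) ?_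
      have hne : ∀ᵐ x ∂vol, x ≠ 0 := ae_restrict_of_ae (by simp [ae_iff])
      filter_upwards [Lp.coeFn_sub f (mS.toLp _), hf, mS.coeFn_toLp, hne] with x k1 k2 k3 k4
      rw [k1, Pi.sub_apply, k2, k3]
      rcases lt_or_gt_of_ne k4 with h | h
      · have h' := neg_pos.2 h
        have := hsm (-x) h'
        rw [neg_neg] at this
        rw [glue_of_neg _ _ h, glue_of_neg _ _ h, this, besselCombo_eq_add_remainder hν am bm h']
        ring
      · rw [glue_of_pos _ _ h, glue_of_pos _ _ h, hsp x h, besselCombo_eq_add_remainder hν ap bp h]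
        ring
    · linear_combination t₁
    · linear_combination t₂
  · refine solvesWeakly_of_hasDerivAt dg (fun x hx => ?_) hf
    refine (hasDerivAt_glue (fun y hy => (dc' am bm y hy).neg) (dc' ap bp) hx).congr_deriv ?_
    rcases lt_or_gt_of_ne hx with h | h
    · rw [glue_of_neg _ _ h, glue_of_neg _ _ h, neg_neg, neg_sq]
    · rw [glue_of_pos _ _ h, glue_of_pos _ _ h]

theorem exists_ae_eq_glue_of_mem_eigenspace (hE : 0 < E) {f : L2}
    (hf : f ∈ eigenspace (op ν) E) :
    ∃ am bm ap bp : ℝ, f =ᵐ[vol] glue (besselCombo ν E am bm) (besselCombo ν E ap bp) ∧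
      besselCoeff ν E 0 * (am + ap) + besselCoeff (-ν) E 0 * (bm + bp) = 0 ∧
      (ν + 1 / 2) * besselCoeff ν E 0 * (am - ap)
        + (-ν + 1 / 2) * besselCoeff (-ν) E 0 * (bm - bp) = 0 ∧
      besselCombo ν E am bm 1 = 0 ∧ besselCombo ν E ap bp 1 = 0 := by
  obtain ⟨⟨vm, vp, fr, hfr, fs, c₁m, c₂m, c₁p, c₂p, hsum, hfs, t₁, t₂⟩, hsol⟩ :=
    mem_eigenspace_iff.1 hf
  obtain ⟨am, bm, h1, h2, h3, h4⟩ := exists_coeff_half hν hE (Or.inr rfl) hsol vm hfr hsum hfs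
    (c₁ := c₁m) (c₂ := c₂m) fun x hx => by
      rw [neg_one_mul, singularFun, if_pos (neg_lt_zero.2 hx), abs_neg, abs_of_pos hx]
  obtain ⟨ap, bp, k1, k2, k3, k4⟩ := exists_coeff_half hν hE (Or.inl rfl) hsol vp hfr hsum hfs
    (c₁ := c₁p) (c₂ := c₂p) fun x hx => by
      rw [one_mul, singularFun, if_neg hx.not_gt, abs_of_pos hx]
  simp only [neg_one_mul] at h1
  simp only [one_mul] at k1
  subst h2 h3 k2 k3
  exact ⟨am, bm, ap, bp, ae_eq_glue h1 k1, by linear_combination t₁, by linear_combination t₂,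
    h4, k4⟩

/-- Linear independence: value and derivative at one point give a system whose determinant is the
Wronskian. -/
theorem eq_zero_of_besselCombo_ae_eq_zero (hE : 0 < E) {a b : ℝ}
    (h : ∀ᵐ x ∂volHalf, besselCombo ν E a b x = 0) : a = 0 ∧ b = 0 := by
  have hα := entireCoeff_besselCoeff (by linarith [hν.1] : -1 < ν) E
  have hβ := entireCoeff_besselCoeff (by linarith [hν.2] : -1 < -ν) E
  have hz : EqOn (besselCombo ν E a b) (fun _ => 0) (Ioo 0 1) :=
    Measure.eqOn_open_of_ae_eq h isOpen_Ioo
      ((continuousOn_combo hα hβ a b).mono Ioo_subset_Ioi_self) continuousOn_const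
  have hx : (1 / 2 : ℝ) ∈ Ioo (0 : ℝ) 1 := by norm_num
  have h1 : a * besselSol ν E (1 / 2) + b * besselSol (-ν) E (1 / 2) = 0 := hz hx
  have h2 : a * besselSolDeriv ν E (1 / 2) + b * besselSolDeriv (-ν) E (1 / 2) = 0 := by
    have d : HasDerivAt (besselCombo ν E a b)
      (a * besselSolDeriv ν E (1 / 2) + b * besselSolDeriv (-ν) E (1 / 2)) (1 / 2) :=
      hasDerivAt_combo hα hβ a b hx.1
    exact d.unique ((hasDerivAt_const _ (0 : ℝ)).congr_of_eventuallyEq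
      (hz.eventuallyEq_of_mem (isOpen_Ioo.mem_nhds hx)))
  have hW := wronskian_besselSol_ne_zero hν hE hx.1
  constructor
  · refine (mul_eq_zero.1 ?_).resolve_right hW
    linear_combination besselSolDeriv (-ν) E (1 / 2) * h1 - besselSol (-ν) E (1 / 2) * h2
  · refine (mul_eq_zero.1 ?_).resolve_right hW
    linear_combination besselSol ν E (1 / 2) * h2 - besselSolDeriv ν E (1 / 2) * h1

/-! ### The boundary and transmission conditions as a linear system. -/

omit hν in
theorem besselCombo_one (hE : 0 < E) (a b : ℝ) :
    besselCombo ν E a b 1 = a * besselJ ν √E + b * besselJ (-ν) √E := by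
  have h1 := besselSol_eq ν hE one_pos
  have h2 := besselSol_eq (-ν) hE one_pos
  rw [Real.sqrt_one, one_mul, mul_one] at h1 h2
  rw [← h1, ← h2]
  rfl

theorem besselJ_ne_zero_of_eq_zero (hE : 0 < E) (h : besselJ ν √E = 0) : besselJ (-ν) √E ≠ 0 := by
  intro h'
  have hW := wronskian_besselSol_ne_zero hν hE one_pos
  rw [besselSol_eq ν hE one_pos, besselSol_eq (-ν) hE one_pos, mul_one, h, h'] at hW
  simp at hW

/-- The origin of the constant `R`: dividing the transmission conditions by the leading coefficient
of the `J_ν` solution leaves it as the only parameter besides `ν`. -/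
theorem besselCoeff_eq_ratio_mul (hE : 0 < E) :
    besselCoeff (-ν) E 0 = ratio ν E * besselCoeff ν E 0 := by
  have hs : 0 < √E / 2 := by have := Real.sqrt_pos.2 hE; positivity
  have h1 := (Real.Gamma_pos_of_pos (by linarith [hν.1] : 0 < ν + 1)).ne'
  have h2 := (Real.Gamma_pos_of_pos (by linarith [hν.2] : 0 < 1 - ν)).ne'
  rw [besselCoeff_zero, besselCoeff_zero, ratio, neg_add_eq_sub]
  have : (√E / 2) ^ (-ν) = (√E / 2) ^ (-2 * ν) * (√E / 2) ^ ν := by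
    rw [← Real.rpow_add hs]; ring_nf
  rw [this]
  field_simp

theorem ratio_pos (hE : 0 < E) : 0 < ratio ν E := by
  have hs : 0 < √E / 2 := by have := Real.sqrt_pos.2 hE; positivity
  have h1 := Real.Gamma_pos_of_pos (by linarith [hν.1] : 0 < ν + 1)
  have h2 := Real.Gamma_pos_of_pos (by linarith [hν.2] : 0 < 1 - ν)
  rw [ratio]
  positivity

/-- The eigenspace in terms of the coefficients of the Bessel solutions on the two halves. -/
theorem mem_eigenspace_op_iff (hE : 0 < E) {f : L2} :
    f ∈ eigenspace (op ν) E ↔ ∃ am bm ap bp : ℝ,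
      f =ᵐ[vol] glue (besselCombo ν E am bm) (besselCombo ν E ap bp) ∧
      am + ap + ratio ν E * (bm + bp) = 0 ∧
      (1 + 2 * ν) * (am - ap) + (1 - 2 * ν) * ratio ν E * (bm - bp) = 0 ∧
      am * besselJ ν √E + bm * besselJ (-ν) √E = 0 ∧
      ap * besselJ ν √E + bp * besselJ (-ν) √E = 0 := by
  have h0 := (besselCoeff_zero_pos (by linarith [hν.1] : -1 < ν) hE).ne'
  have hr := besselCoeff_eq_ratio_mul hν hE
  constructor
  · intro h
    obtain ⟨am, bm, ap, bp, k0, k1, k2, k3, k4⟩ := exists_ae_eq_glue_of_mem_eigenspace hν hE h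
    rw [besselCombo_one hE] at k3 k4
    rw [hr] at k1 k2
    refine ⟨am, bm, ap, bp, k0, mul_left_cancel₀ h0 ?_, mul_left_cancel₀ h0 ?_, k3, k4⟩
    · linear_combination k1
    · linear_combination 2 * k2
  · rintro ⟨am, bm, ap, bp, k0, k1, k2, k3, k4⟩
    refine mem_eigenspace_of_ae_eq_glue hν k0 ?_ ?_ ?_ ?_
    · rw [hr]; linear_combination besselCoeff ν E 0 * k1
    · rw [hr]; linear_combination besselCoeff ν E 0 / 2 * k2
    · rw [besselCombo_one hE, k3]
    · rw [besselCombo_one hE, k4]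

omit hν in
theorem glue_besselCombo_smul (c am bm ap bp : ℝ) (x : ℝ) :
    glue (besselCombo ν E (c * am) (c * bm)) (besselCombo ν E (c * ap) (c * bp)) x
      = c * glue (besselCombo ν E am bm) (besselCombo ν E ap bp) x := by
  simp only [glue, besselCombo, combo]
  split_ifs <;> ring

/-- If all solutions of the boundary and transmission conditions are multiples of one of them, then
the eigenspace is the line spanned by the corresponding function. -/
theorem eigenspace_eq_span (hE : 0 < E) {am bm ap bp : ℝ} {g : ℝ → ℝ} (hbp : bp ≠ 0)
    (hg : g =ᵐ[vol] glue (besselCombo ν E am bm) (besselCombo ν E ap bp))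
    (h1 : am + ap + ratio ν E * (bm + bp) = 0)
    (h2 : (1 + 2 * ν) * (am - ap) + (1 - 2 * ν) * ratio ν E * (bm - bp) = 0)
    (h3 : am * besselJ ν √E + bm * besselJ (-ν) √E = 0)
    (h4 : ap * besselJ ν √E + bp * besselJ (-ν) √E = 0)
    (huniq : ∀ am' bm' ap' bp' : ℝ, am' + ap' + ratio ν E * (bm' + bp') = 0 →
      (1 + 2 * ν) * (am' - ap') + (1 - 2 * ν) * ratio ν E * (bm' - bp') = 0 →
      am' * besselJ ν √E + bm' * besselJ (-ν) √E = 0 →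
      ap' * besselJ ν √E + bp' * besselJ (-ν) √E = 0 →
      ∃ c : ℝ, am' = c * am ∧ bm' = c * bm ∧ ap' = c * ap ∧ bp' = c * bp) :
    (∃ h : MemLp g 2 vol, eigenspace (op ν) E = Submodule.span ℝ {h.toLp g}) ∧
      Module.finrank ℝ (eigenspace (op ν) E) = 1 := by
  have hm : MemLp g 2 vol :=
    (memLp_glue (memLp_besselCombo hν am bm) (memLp_besselCombo hν ap bp)).ae_eq hg.symm
  have hspan : eigenspace (op ν) E = Submodule.span ℝ {hm.toLp g} := by
    refine le_antisymm (fun f hf => ?_) ?_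
    · obtain ⟨am', bm', ap', bp', k0, k1, k2, k3, k4⟩ := (mem_eigenspace_op_iff hν hE).1 hf
      obtain ⟨c, rfl, rfl, rfl, rfl⟩ := huniq am' bm' ap' bp' k1 k2 k3 k4
      refine Submodule.mem_span_singleton.2 ⟨c, Lp.ext ?_⟩
      filter_upwards [Lp.coeFn_smul c (hm.toLp g), hm.coeFn_toLp, hg, k0] with x e1 e2 e3 e4
      rw [e1, Pi.smul_apply, e2, e3, e4, glue_besselCombo_smul, smul_eq_mul]
    · rw [Submodule.span_singleton_le_iff_mem]
      exact (mem_eigenspace_op_iff hν hE).2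
        ⟨am, bm, ap, bp, hm.coeFn_toLp.trans hg, h1, h2, h3, h4⟩
  refine ⟨⟨hm, hspan⟩, ?_⟩
  rw [hspan]
  refine finrank_span_singleton fun h0 => hbp ?_
  have hz : ∀ᵐ x ∂vol, glue (besselCombo ν E am bm) (besselCombo ν E ap bp) x = 0 := by
    filter_upwards [hg, hm.coeFn_toLp, Lp.coeFn_zero ℝ 2 vol] with x e1 e2 e3
    rw [← e1, ← e2, h0, e3, Pi.zero_apply]
  refine (eq_zero_of_besselCombo_ae_eq_zero hν hE (a := ap) (b := bp) ?_).2
  filter_upwards [ae_volHalf_of_ae_vol (Or.inl rfl) hz, ae_restrict_mem measurableSet_Ioo]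
    with x hx hx'
  rwa [one_mul, glue_of_pos _ _ hx'.1] at hx

theorem exists_coeff_of_isEigenvalue (hE : 0 < E) (h : IsEigenvalue (op ν) E) :
    ∃ am bm ap bp : ℝ, ¬(am = 0 ∧ bm = 0 ∧ ap = 0 ∧ bp = 0) ∧
      am + ap + ratio ν E * (bm + bp) = 0 ∧
      (1 + 2 * ν) * (am - ap) + (1 - 2 * ν) * ratio ν E * (bm - bp) = 0 ∧
      am * besselJ ν √E + bm * besselJ (-ν) √E = 0 ∧
      ap * besselJ ν √E + bp * besselJ (-ν) √E = 0 := by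
  obtain ⟨⟨f, hf⟩, hne, hfE⟩ := h
  obtain ⟨am, bm, ap, bp, k0, k⟩ := (mem_eigenspace_op_iff hν hE).1 ⟨hf, hfE⟩
  refine ⟨am, bm, ap, bp, ?_, k⟩
  rintro ⟨rfl, rfl, rfl, rfl⟩
  refine hne (Subtype.ext (Lp.ext ?_))
  filter_upwards [k0, Lp.coeFn_zero ℝ 2 vol] with x e1 e2
  change f x = (0 : L2) x
  rw [e1, e2]
  simp [glue, combo]

/-- If `J_ν(√E) = 0`, then `J_{-ν}(√E) ≠ 0` and the Dirichlet conditions force `bm = bp = 0`. The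
transmission conditions then annihilate `am + ap` and `am - ap`. -/
theorem besselJ_ne_zero_of_isEigenvalue (hE : 0 < E) (h : IsEigenvalue (op ν) E) :
    besselJ ν √E ≠ 0 := by
  intro h0
  have h0' := besselJ_ne_zero_of_eq_zero hν hE h0
  obtain ⟨am, bm, ap, bp, hne, k1, k2, k3, k4⟩ := exists_coeff_of_isEigenvalue hν hE h
  rw [h0, mul_zero, zero_add] at k3 k4
  have hbm := (mul_eq_zero.1 k3).resolve_right h0'
  have hbp := (mul_eq_zero.1 k4).resolve_right h0'
  subst hbm hbp
  have h12 : 1 + 2 * ν ≠ 0 := by linarith [hν.1]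
  have e1 : am - ap = 0 := (mul_eq_zero.1 (by linear_combination k2)).resolve_left h12
  have e2 : am + ap = 0 := by linear_combination k1
  exact hne ⟨by linarith, rfl, by linarith, rfl⟩

theorem condition_of_isEigenvalue (hE : 0 < E) (h : IsEigenvalue (op ν) E) :
    ratio ν E * besselJ ν √E = besselJ (-ν) √E ∨
      (1 - 2 * ν) * ratio ν E * besselJ ν √E = (1 + 2 * ν) * besselJ (-ν) √E := by
  have hJ := besselJ_ne_zero_of_isEigenvalue hν hE h
  obtain ⟨am, bm, ap, bp, hne, k1, k2, k3, k4⟩ := exists_coeff_of_isEigenvalue hν hE h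
  -- Eliminating `am + ap` leaves an equation for `bm + bp`, and eliminating `am - ap` one for `bm -
  -- bp`. If neither condition holds, both combinations vanish.
  have e1 : (bm + bp) * (ratio ν E * besselJ ν √E - besselJ (-ν) √E) = 0 := by
    linear_combination besselJ ν √E * k1 - k3 - k4
  have e2 : (bm - bp) * ((1 - 2 * ν) * ratio ν E * besselJ ν √E
      - (1 + 2 * ν) * besselJ (-ν) √E) = 0 := by
    linear_combination besselJ ν √E * k2 - (1 + 2 * ν) * k3 + (1 + 2 * ν) * k4
  by_contra! hcon
  have z1 := (mul_eq_zero.1 e1).resolve_right (sub_ne_zero.2 hcon.1)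
  have z2 := (mul_eq_zero.1 e2).resolve_right (sub_ne_zero.2 hcon.2)
  have hbm : bm = 0 := by linarith
  have hbp : bp = 0 := by linarith
  subst hbm hbp
  rw [zero_mul, add_zero] at k3 k4
  exact hne ⟨(mul_eq_zero.1 k3).resolve_right hJ, rfl, (mul_eq_zero.1 k4).resolve_right hJ, rfl⟩

/-! ### The even and odd generators. -/

omit hν in
theorem evenFun_ae_eq (hE : 0 < E) : evenFun ν E =ᵐ[vol]
    glue (besselCombo ν E (-ratio ν E) 1) (besselCombo ν E (-ratio ν E) 1) := by
  refine ae_eq_glue ?_ ?_ <;> filter_upwards [ae_restrict_mem measurableSet_Ioo] with x hx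
  · have e : besselCombo ν E (-ratio ν E) 1 x
        = -ratio ν E * besselSol ν E x + 1 * besselSol (-ν) E x := rfl
    rw [e, besselSol_eq ν hE hx.1, besselSol_eq (-ν) hE hx.1, evenFun, if_pos (neg_lt_zero.2 hx.1),
      neg_neg, neg_mul_neg]
    ring
  · have e : besselCombo ν E (-ratio ν E) 1 x
        = -ratio ν E * besselSol ν E x + 1 * besselSol (-ν) E x := rfl
    rw [e, besselSol_eq ν hE hx.1, besselSol_eq (-ν) hE hx.1, evenFun, if_neg hx.1.not_gt]
    ring

omit hν in
theorem oddFun_ae_eq (hE : 0 < E) : oddFun ν E =ᵐ[vol]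
    glue (besselCombo ν E ((1 - 2 * ν) / (1 + 2 * ν) * ratio ν E) (-1))
      (besselCombo ν E (-((1 - 2 * ν) / (1 + 2 * ν) * ratio ν E)) 1) := by
  have e : ∀ a b x, besselCombo ν E a b x = a * besselSol ν E x + b * besselSol (-ν) E x :=
    fun _ _ _ => rfl
  refine ae_eq_glue ?_ ?_ <;> filter_upwards [ae_restrict_mem measurableSet_Ioo] with x hx
  · rw [e, besselSol_eq ν hE hx.1, besselSol_eq (-ν) hE hx.1, oddFun, if_pos (neg_lt_zero.2 hx.1),
      neg_neg, neg_mul_neg]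
    ring
  · rw [e, besselSol_eq ν hE hx.1, besselSol_eq (-ν) hE hx.1, oddFun, if_neg hx.1.not_gt]
    ring

theorem eigenspace_even (hE : 0 < E) (h : ratio ν E * besselJ ν √E = besselJ (-ν) √E) :
    (∃ h : MemLp (evenFun ν E) 2 vol,
      eigenspace (op ν) E = Submodule.span ℝ {h.toLp (evenFun ν E)}) ∧
      Module.finrank ℝ (eigenspace (op ν) E) = 1 := by
  have hJ : besselJ ν √E ≠ 0 := fun h0 =>
    besselJ_ne_zero_of_eq_zero hν hE h0 (by rw [← h, h0, mul_zero])
  refine eigenspace_eq_span hν hE one_ne_zero (evenFun_ae_eq hE) (by ring) (by ring)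
    (by rw [← h]; ring) (by rw [← h]; ring) fun am bm ap bp k1 k2 k3 k4 => ?_
  rw [← h] at k3 k4
  have e3 : am = -(bm * ratio ν E) := by
    refine mul_right_cancel₀ hJ ?_
    linear_combination k3
  have e4 : ap = -(bp * ratio ν E) := by
    refine mul_right_cancel₀ hJ ?_
    linear_combination k4
  -- After substitution of `am` and `ap`, the second transmission condition reads `-4 ν R (bm - bp)
  -- = 0`.
  have hc : 4 * ν * ratio ν E ≠ 0 := by
    have := ratio_pos hν hE
    have := hν.1
    positivity
  have e5 : bm = bp := by
    refine mul_left_cancel₀ hc ?_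
    rw [e3, e4] at k2
    linear_combination -k2
  exact ⟨bp, by rw [e3, e5]; ring, by rw [e5]; ring, by rw [e4]; ring, by ring⟩

theorem eigenspace_odd (hE : 0 < E)
    (h : (1 - 2 * ν) / (1 + 2 * ν) * ratio ν E * besselJ ν √E = besselJ (-ν) √E) :
    (∃ h : MemLp (oddFun ν E) 2 vol,
      eigenspace (op ν) E = Submodule.span ℝ {h.toLp (oddFun ν E)}) ∧
      Module.finrank ℝ (eigenspace (op ν) E) = 1 := by
  have hJ : besselJ ν √E ≠ 0 := fun h0 =>
    besselJ_ne_zero_of_eq_zero hν hE h0 (by rw [← h, h0, mul_zero])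
  have h12 : 1 + 2 * ν ≠ 0 := by linarith [hν.1]
  set ρ := (1 - 2 * ν) / (1 + 2 * ν) with hρ
  have hρ' : (1 + 2 * ν) * ρ = 1 - 2 * ν := mul_div_cancel₀ _ h12
  have hodd := oddFun_ae_eq (ν := ν) hE
  rw [← hρ] at hodd
  refine eigenspace_eq_span hν hE one_ne_zero hodd (by ring)
    (by linear_combination 2 * ratio ν E * hρ') (by rw [← h]; ring) (by rw [← h]; ring)
    fun am bm ap bp k1 k2 k3 k4 => ?_
  rw [← h] at k3 k4
  have e3 : am = -(bm * (ρ * ratio ν E)) := by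
    refine mul_right_cancel₀ hJ ?_
    linear_combination k3
  have e4 : ap = -(bp * (ρ * ratio ν E)) := by
    refine mul_right_cancel₀ hJ ?_
    linear_combination k4
  -- Here the first transmission condition is `(1 - ρ) R (bm + bp) = 0`, and `(1 + 2ν)(1 - ρ) = 4ν`.
  have hc : 4 * ν * ratio ν E ≠ 0 := by
    have := ratio_pos hν hE
    have := hν.1
    positivity
  have e5 : bm = -bp := by
    refine mul_left_cancel₀ hc ?_
    rw [e3, e4] at k1
    linear_combination (1 + 2 * ν) * k1 + ratio ν E * (bm + bp) * hρ'
  exact ⟨bp, by rw [e3, e5]; ring, by rw [e5]; ring, by rw [e4]; ring, by ring⟩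

omit hν in
theorem isEigenvalue_of_finrank (h : Module.finrank ℝ (eigenspace (op ν) E) = 1) :
    IsEigenvalue (op ν) E := by
  have : Nontrivial (eigenspace (op ν) E) := Module.nontrivial_of_finrank_eq_succ h
  obtain ⟨⟨f, hf, hE⟩, hne⟩ := exists_ne (0 : eigenspace (op ν) E)
  refine ⟨⟨f, hf⟩, fun h0 => hne (Subtype.ext (Subtype.ext_iff.1 h0 :)), hE⟩

end

end InvSq

theorem mainTheorem9 (ν : ℝ) (hν : ν ∈ Set.Ioo (0 : ℝ) 1) (E : ℝ) (hE : 0 < E) :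
    (InvSq.IsEigenvalue (InvSq.op ν) E ↔
      (InvSq.besselJ ν (√E) * (√E / 2) ^ (-2 * ν) * (Real.Gamma (ν + 1) / Real.Gamma (1 - ν))
          = InvSq.besselJ (-ν) (√E) ∨
        InvSq.besselJ ν (√E) * (√E / 2) ^ (-2 * ν) * (Real.Gamma (ν + 1) / Real.Gamma (1 - ν))
            * ((1 - 2 * ν) / (1 + 2 * ν))
          = InvSq.besselJ (-ν) (√E))) ∧
    (InvSq.IsEigenvalue (InvSq.op ν) E → InvSq.besselJ ν (√E) ≠ 0) ∧
    (InvSq.besselJ ν (√E) * (√E / 2) ^ (-2 * ν) * (Real.Gamma (ν + 1) / Real.Gamma (1 - ν))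
          = InvSq.besselJ (-ν) (√E) →
      (∃ h : MemLp (InvSq.evenFun ν E) 2 InvSq.vol,
        InvSq.eigenspace (InvSq.op ν) E = Submodule.span ℝ {h.toLp (InvSq.evenFun ν E)}) ∧
      Module.finrank ℝ (InvSq.eigenspace (InvSq.op ν) E) = 1) ∧
    (InvSq.besselJ ν (√E) * (√E / 2) ^ (-2 * ν) * (Real.Gamma (ν + 1) / Real.Gamma (1 - ν))
            * ((1 - 2 * ν) / (1 + 2 * ν))
          = InvSq.besselJ (-ν) (√E) →
      (∃ h : MemLp (InvSq.oddFun ν E) 2 InvSq.vol,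
        InvSq.eigenspace (InvSq.op ν) E = Submodule.span ℝ {h.toLp (InvSq.oddFun ν E)}) ∧
      Module.finrank ℝ (InvSq.eigenspace (InvSq.op ν) E) = 1) := by
  have h12 : 1 + 2 * ν ≠ 0 := by linarith [hν.1]
  have e1 : InvSq.besselJ ν (√E) * (√E / 2) ^ (-2 * ν)
      * (Real.Gamma (ν + 1) / Real.Gamma (1 - ν)) = InvSq.ratio ν E * InvSq.besselJ ν √E := by
    rw [InvSq.ratio]; ring
  have e2 : InvSq.ratio ν E * InvSq.besselJ ν √E * ((1 - 2 * ν) / (1 + 2 * ν))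
      = (1 - 2 * ν) / (1 + 2 * ν) * InvSq.ratio ν E * InvSq.besselJ ν √E := by ring
  rw [e1, e2]
  have even := InvSq.eigenspace_even hν hE
  have odd := InvSq.eigenspace_odd hν hE
  refine ⟨⟨fun h => ?_, ?_⟩, InvSq.besselJ_ne_zero_of_isEigenvalue hν hE, even, odd⟩
  · refine (InvSq.condition_of_isEigenvalue hν hE h).imp_right fun h => ?_
    refine mul_left_cancel₀ h12 (Eq.trans ?_ h)
    field_simp
  · rintro (h | h)
    · exact InvSq.isEigenvalue_of_finrank (even h).2
    · exact InvSq.isEigenvalue_of_finrank (odd h).2
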